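/- For unit vectors $p,q\in\mathbb R^3$ let $\zeta(p,q)=\arccos\langle p,q\rangle$ be their geodesic distance on the unit sphere $\mathbb S$. For a finite set $S\subset\mathbb S$ with at least two points, the gap ratio is $$\rho(S)=\frac{\max_{p\in\mathbb S}\min_{q\in S}2\,\zeta(p,q)}{\min_{p,q\in S,\ p\ne q}\zeta(p,q)},$$ the spherical diameter of the largest empty circle divided by the minimum pairwise geodesic distance. The triangular dissection of a spherical triangle $\langle u_1,u_2,u_3\rangle$ replaces it by the four triangles $\langle u_1,u_{12},u_{13}\rangle$, $\langle u_{12},u_2,u_{23}\rangle$, $\langle u_3,u_{13},u_{23}\rangle$, $\langle u_{12},u_{13},u_{23}\rangle$, where $u_{ij}$ is the midpoint of the great-circle arc from $u_i$ to $u_j$. Let $V$ be the set of the 12 vertices of a regular icosahedron inscribed in $\mathbb S$. Let the depth-$0$ tessellation consist of its 20 equilateral spherical faces, and let the depth-$(k+1)$ tessellation be obtained by dissecting every triangle of the depth-$k$ tessellation. Let $V_k$ be the set of vertices of the depth-$k$ tessellation, so that $V_0=V\subset V_1\subset V_2\subset\cdots$. The icosahedral triangular dissection places an infinite sequence of points $p_1,p_2,\dots$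 without repetition. In stage one it places the 12 points of $V$, with $p_2=-p_1$ and the other ten in any order. In stage two it places, for $k=1,2,\dots$ in turn, the points of $V_k\setminus V_{k-1}$, in any order within each depth $k$. **Theorem.** Such sequences exist. For every such sequence, with $S_i=\{p_1,\dots,p_i\}$, the gap ratio of the sequence is $$\max_{i\ge 2}\rho(S_i)=\frac{\pi}{\arccos(1/\sqrt5)}\approx 2.8376;$$ that is, $\rho(S_i)\le \pi/\arccos(1/\sqrt5)$ for every $i\ge2$, with equality for some $i$. Moreover, once stage one is complete, $\rho(S_i)\le \dfrac{12-4\sqrt5}{\arccos(1/\sqrt5)}\approx 2.760$ for every $i\ge 12$. -/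

import Mathlib

open Real

noncomputable section

/-- Euclidean three-space. -/
abbrev E3 : Type := EuclideanSpace ℝ (Fin 3)

/-- The geodesic (great-circle) distance of two points of the unit sphere: the angle between
the two unit vectors. -/
def sphDist (p q : E3) : ℝ := InnerProductGeometry.angle p q

/-- The minimum pairwise geodesic distance of a point set (meaningful for at least two points). -/
def minGap (S : Set E3) : ℝ :=
  sInf {d : ℝ | ∃ p ∈ S, ∃ q ∈ S, p ≠ q ∧ d = sphDist p q}

/-- The spherical diameter of the largest empty circle centred at a point of the unit sphere. -/
def maxGap (S : Set E3) : ℝ :=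
  ⨆ p : Metric.sphere (0 : E3) 1, ⨅ q : S, 2 * sphDist (p : E3) (q : E3)

/-- The gap ratio of a configuration of points on the unit sphere. -/
def gapRatio (S : Set E3) : ℝ := maxGap S / minGap S

/-- The midpoint, on the unit sphere, of the shorter great-circle arc between two non-antipodal
unit vectors. -/
def sphMidpoint (a b : E3) : E3 := ‖a + b‖⁻¹ • (a + b)

/-- A spherical triangle, given by its three vertices (in some order). -/
@[ext]
structure SphTriangle where
  u₁ : E3
  u₂ : E3
  u₃ : E3

/-- The vertex set of a spherical triangle. -/
def SphTriangle.vertices (T : SphTriangle) : Set E3 := {T.u₁, T.u₂, T.u₃}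

/-- The triangular dissection of a spherical triangle into four, through the midpoints of its
edges. -/
def SphTriangle.dissect (T : SphTriangle) : Set SphTriangle :=
  let u₁₂ := sphMidpoint T.u₁ T.u₂
  let u₁₃ := sphMidpoint T.u₁ T.u₃
  let u₂₃ := sphMidpoint T.u₂ T.u₃
  {⟨T.u₁, u₁₂, u₁₃⟩, ⟨u₁₂, T.u₂, u₂₃⟩, ⟨T.u₃, u₁₃, u₂₃⟩, ⟨u₁₂, u₁₃, u₂₃⟩}

/-- The dissection of every triangle of a family. -/
def dissectAll (F : Set SphTriangle) : Set SphTriangle := ⋃ T ∈ F, T.dissect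

/-- The twelve vertices of a regular icosahedron centred at the origin:
`(0, ±1, ±φ)` and its cyclic permutations, where `φ` is the golden ratio. -/
def icosahedronRaw : Set E3 :=
  {w : E3 | ∃ s ∈ ({1, -1} : Set ℝ), ∃ t ∈ ({1, -1} : Set ℝ),
    w = !₂[0, s, t * goldenRatio] ∨ w = !₂[t * goldenRatio, 0, s] ∨
      w = !₂[s, t * goldenRatio, 0]}

/-- The vertices of a regular icosahedron projected to the unit sphere. The linear isometry `g`
of the space gives the position of the icosahedron. -/
def icosahedron (g : E3 ≃ₗᵢ[ℝ] E3) : Set E3 :=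
  (fun w : E3 => g (‖w‖⁻¹ • w)) '' icosahedronRaw

/-- The faces of the spherical icosahedron: the triangles with three icosahedron vertices that
are pairwise at the minimum distance. Each of the twenty faces occurs with all orderings of its
vertices; this does not affect the points that the dissection produces. -/
def icosahedronFaces (g : E3 ≃ₗᵢ[ℝ] E3) : Set SphTriangle :=
  {T : SphTriangle | T.u₁ ∈ icosahedron g ∧ T.u₂ ∈ icosahedron g ∧ T.u₃ ∈ icosahedron g ∧
    T.u₁ ≠ T.u₂ ∧ T.u₁ ≠ T.u₃ ∧ T.u₂ ≠ T.u₃ ∧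
    sphDist T.u₁ T.u₂ = minGap (icosahedron g) ∧
    sphDist T.u₁ T.u₃ = minGap (icosahedron g) ∧
    sphDist T.u₂ T.u₃ = minGap (icosahedron g)}

/-- The triangles of the depth-`k` tessellation of the sphere. -/
def tessellation (g : E3 ≃ₗᵢ[ℝ] E3) (k : ℕ) : Set SphTriangle :=
  dissectAll^[k] (icosahedronFaces g)

/-- The vertices of the triangles of the depth-`k` tessellation. -/
def tessellationPoints (g : E3 ≃ₗᵢ[ℝ] E3) (k : ℕ) : Set E3 :=
  ⋃ T ∈ tessellation g k, T.vertices

/-- The configuration formed by the first `i` points of a sequence (which starts with `p 0`). -/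
def prefixConfig (p : ℕ → E3) (i : ℕ) : Set E3 := p '' Set.Iio i

/-- The infinite sequences of points that the icosahedral two-stage algorithm can produce:
no point is placed twice; stage one places the twelve icosahedron vertices, an antipodal pair
first and the other ten in any order; stage two completes the depth-`k` tessellations one after
the other for `k = 1, 2, …`, the new points of each depth being placed in any order. -/
structure IsIcosahedralSequence (g : E3 ≃ₗᵢ[ℝ] E3) (p : ℕ → E3) : Prop where
  injective : Function.Injective p
  antipodal : p 1 = -p 0
  stage_one : prefixConfig p 12 = icosahedron g
  stage_two : ∀ k : ℕ, ∃ n : ℕ, prefixConfig p n = tessellationPoints g k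

end

/-! ### Unit vectors, midpoints and edge lengths -/

/-! Write `α = arccos (1 / √5)` for the edge of the spherical icosahedron. In stage one all points
are icosahedron vertices, so the minimum gap is at least `α`, while the antipodal pair keeps every
point of the sphere within `π / 2` of the configuration: the ratio is at most `π / α`. Three points
attain it, because some point orthogonal to the axis of the pair is at least `π / 2` away from the
third (`gapRatio_three`).

In stage two every prefix lies between the vertex sets of some depths `k` and `k + 1`. Two
inductions on edge lengths (`EdgeBounds.corner`, `EdgeBounds.central`) control it. Dissection makes
no edge shorter than half the previous minimum, since a spherical midline is at least half the
opposite side. It makes no edge longer than the side of the medial triangle of an equilateral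
triangle, and for the latter the tangent of the circumradius halves. Hence every point of the sphere
is within `(3 - √5) / 2 ^ k` of a depth-`k` vertex, all edges at depth `k + 1` are at least `α / 2 ^
(k + 1)`, and twice the former over the latter is `(12 - 4 * √5) / α`, which is below `π / α`.

Edge lengths say nothing about two vertices without a common triangle. For these
(`inner_le_of_hasHats`) each vertex gets a hat function, linear on the cone over each triangle. The
difference of the hats of `p` and `q` drops by `2` from `p` to `q`, and on each cone it is zero or
plus or minus a single barycentric coordinate. The triangles being nearly equilateral, that
coordinate has Lipschitz constant at most `√(2 / (1 - A))`, where `A` is the cosine of the minimal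
edge; so `‖p - q‖ ^ 2 ≥ 2 * (1 - A)`, which is the wanted separation. Hats exist at depth `0`
through the gauge of the icosahedron and pass to the dissection by explicit max-min formulas. They
also show that midpoints are new vertices. -/

lemma sphDist_eq_arccos {p q : E3} (hp : ‖p‖ = 1) (hq : ‖q‖ = 1) :
    sphDist p q = arccos (inner ℝ p q) := by
  simp [sphDist, InnerProductGeometry.angle, hp, hq]

lemma inner_self_of_unit {u : E3} (hu : ‖u‖ = 1) : (inner ℝ u u : ℝ) = 1 := by
  rw [real_inner_self_eq_norm_sq, hu, one_pow]

/-- Cauchy–Schwarz for the components of `v` and `w` orthogonal to `u`. -/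
lemma gram_det_nonneg {u v w : E3} (hu : ‖u‖ = 1) (hv : ‖v‖ = 1) (hw : ‖w‖ = 1) :
    0 ≤ 1 + 2 * inner ℝ u v * inner ℝ u w * inner ℝ v w
      - inner ℝ u v ^ 2 - inner ℝ u w ^ 2 - inner ℝ v w ^ 2 := by
  have h := real_inner_mul_inner_self_le (v - (inner ℝ u v : ℝ) • u) (w - (inner ℝ u w : ℝ) • u)
  simp only [inner_sub_left, inner_sub_right, real_inner_smul_left, real_inner_smul_right,
    inner_self_of_unit hu, inner_self_of_unit hv, inner_self_of_unit hw, real_inner_comm u v,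
    real_inner_comm u w] at h
  nlinarith [h]

lemma norm_add_sq_of_unit {u v : E3} (hu : ‖u‖ = 1) (hv : ‖v‖ = 1) :
    ‖u + v‖ ^ 2 = 2 + 2 * inner ℝ u v := by
  rw [norm_add_sq_real, hu, hv]; ring

lemma norm_add_pos_of_unit {u v : E3} (hu : ‖u‖ = 1) (hv : ‖v‖ = 1)
    (h : -1 < inner ℝ u v) : 0 < ‖u + v‖ := by
  have := norm_add_sq_of_unit hu hv
  have h0 := norm_nonneg (u + v)
  rcases h0.eq_or_lt with h0 | h0
  · rw [← h0] at this; linarith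
  · exact h0

lemma norm_sphMidpoint {u v : E3} (h : 0 < ‖u + v‖) : ‖sphMidpoint u v‖ = 1 := by
  rw [sphMidpoint, norm_smul, norm_inv, norm_norm, inv_mul_cancel₀ h.ne']

lemma sphMidpoint_comm (u v : E3) : sphMidpoint u v = sphMidpoint v u := by
  simp [sphMidpoint, add_comm]

lemma inner_sphMidpoint_self {u v : E3} (hu : ‖u‖ = 1) (hv : ‖v‖ = 1) (h : 0 < ‖u + v‖) :
    inner ℝ u (sphMidpoint u v) = ‖u + v‖ / 2 := by
  have h1 := norm_add_sq_of_unit hu hv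
  rw [sphMidpoint, real_inner_smul_right, inner_add_right, real_inner_self_eq_norm_sq, hu]
  field_simp
  linarith

lemma inner_sphMidpoint_sphMidpoint {u v w : E3} (hu : ‖u‖ = 1)
    (h1 : 0 < ‖u + v‖) (h2 : 0 < ‖u + w‖) :
    inner ℝ (sphMidpoint u v) (sphMidpoint u w) * (‖u + v‖ * ‖u + w‖) =
      1 + inner ℝ u v + inner ℝ u w + inner ℝ v w := by
  simp only [sphMidpoint, real_inner_smul_left, real_inner_smul_right, inner_add_left,
    inner_add_right, real_inner_self_eq_norm_sq, hu, real_inner_comm u v]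
  field_simp
  ring

/-- Unit vectors whose pairwise inner products lie between `C` and `A`. -/
structure EdgeBounds (C A : ℝ) (u v w : E3) : Prop where
  norm₁ : ‖u‖ = 1
  norm₂ : ‖v‖ = 1
  norm₃ : ‖w‖ = 1
  le₁₂ : C ≤ inner ℝ u v
  le₁₃ : C ≤ inner ℝ u w
  le₂₃ : C ≤ inner ℝ v w
  ge₁₂ : inner ℝ u v ≤ A
  ge₁₃ : inner ℝ u w ≤ A
  ge₂₃ : inner ℝ v w ≤ A

namespace EdgeBounds

variable {C A C' A' : ℝ} {u v w : E3}

lemma swap (h : EdgeBounds C A u v w) : EdgeBounds C A v u w :=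
  ⟨h.norm₂, h.norm₁, h.norm₃, by rw [real_inner_comm]; exact h.le₁₂, h.le₂₃, h.le₁₃,
    by rw [real_inner_comm]; exact h.ge₁₂, h.ge₂₃, h.ge₁₃⟩

lemma swap' (h : EdgeBounds C A u v w) : EdgeBounds C A u w v :=
  ⟨h.norm₁, h.norm₃, h.norm₂, h.le₁₃, h.le₁₂, by rw [real_inner_comm]; exact h.le₂₃,
    h.ge₁₃, h.ge₁₂, by rw [real_inner_comm]; exact h.ge₂₃⟩

lemma norm_add_pos (h : EdgeBounds C A u v w) (hC : 0 ≤ C) : 0 < ‖u + v‖ :=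
  norm_add_pos_of_unit h.norm₁ h.norm₂ (by linarith [h.le₁₂])

lemma ne₁₂ (h : EdgeBounds C A u v w) (hA : A < 1) : u ≠ v := by
  rintro rfl
  have := h.ge₁₂
  rw [real_inner_self_eq_norm_sq, h.norm₁] at this
  linarith

lemma inner_midpoint_le (h : EdgeBounds C A u v w) (hC : 0 ≤ C) (hA' : 0 ≤ A')
    (h2 : 2 * A' ^ 2 = 1 + A) : inner ℝ u (sphMidpoint u v) ≤ A' := by
  rw [inner_sphMidpoint_self h.norm₁ h.norm₂ (h.norm_add_pos hC)]
  have := norm_add_sq_of_unit h.norm₁ h.norm₂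
  refine le_of_sq_le_sq ?_ hA'
  nlinarith [h.ge₁₂]

/-- `C'` is the cosine of the side of the medial triangle of an equilateral triangle with side
cosine `C`. Half a side is no longer than that: the comparison reduces to `(1 - C) ^ 2 * (1 + 2 * C)
≥ 0`. -/
lemma le_inner_midpoint (h : EdgeBounds C A u v w) (hC : 0 ≤ C)
    (hC' : C' * (2 * (1 + C)) = 1 + 3 * C) : C' ≤ inner ℝ u (sphMidpoint u v) := by
  rw [inner_sphMidpoint_self h.norm₁ h.norm₂ (h.norm_add_pos hC)]
  have h1 := norm_add_sq_of_unit h.norm₁ h.norm₂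
  have h0 := h.norm_add_pos hC
  have e : C' = (1 + 3 * C) / (2 * (1 + C)) := by field_simp; linarith
  have h3 : C' ^ 2 ≤ (1 + C) / 2 := by
    rw [e, div_pow, div_le_div_iff₀ (by positivity) (by positivity)]
    nlinarith [mul_nonneg (sq_nonneg (1 - C)) (by linarith : (0:ℝ) ≤ 1 + 2 * C)]
  refine le_of_sq_le_sq ?_ (by positivity)
  nlinarith [h.le₁₂]

/-- A spherical midline is at least half the opposite side. In cosines this is `2 * (1 + a + b + c)
≤ x * y * z`, and the difference of the squares is a multiple of the Gram determinant. -/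
lemma inner_midpoints_le (h : EdgeBounds C A u v w) (hC : 0 ≤ C) (hA' : 0 ≤ A')
    (h2 : 2 * A' ^ 2 = 1 + A) : inner ℝ (sphMidpoint u v) (sphMidpoint u w) ≤ A' := by
  have p1 := h.norm_add_pos hC
  have p2 := h.swap'.norm_add_pos hC
  have p3 := h.swap.swap'.norm_add_pos hC
  have e := inner_sphMidpoint_sphMidpoint h.norm₁ p1 p2
  have n1 := norm_add_sq_of_unit h.norm₁ h.norm₂
  have n2 := norm_add_sq_of_unit h.norm₁ h.norm₃
  have n3 := norm_add_sq_of_unit h.norm₂ h.norm₃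
  have d := gram_det_nonneg h.norm₁ h.norm₂ h.norm₃
  have g1 := h.le₁₂
  have g2 := h.le₁₃
  have g3 := h.le₂₃
  have g4 := h.ge₂₃
  set a : ℝ := inner ℝ u v
  set b : ℝ := inner ℝ u w
  set c : ℝ := inner ℝ v w
  set x := ‖u + v‖
  set y := ‖u + w‖
  set z := ‖v + w‖
  have hz : z ≤ 2 * A' := by
    refine le_of_sq_le_sq ?_ (by positivity)
    nlinarith
  have key : 2 * (1 + a + b + c) ≤ x * y * z := by
    refine le_of_sq_le_sq ?_ (by positivity)
    rw [mul_pow (x * y), mul_pow x, n1, n2, n3]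
    nlinarith
  have hxy : 0 < x * y := mul_pos p1 p2
  refine le_of_mul_le_mul_right ?_ hxy
  rw [e]
  nlinarith

/-- By AM-GM `x * y ≤ 2 + a + b`, so `1 + a + b + c` falls short of `x * y` by at most `1 - C`; the
bound `2 * (1 + C) ≤ x * y` shows that `C'` allows this deficit. -/
lemma le_inner_midpoints (h : EdgeBounds C A u v w) (hC : 0 ≤ C)
    (hC' : C' * (2 * (1 + C)) = 1 + 3 * C) :
    C' ≤ inner ℝ (sphMidpoint u v) (sphMidpoint u w) := by
  have p1 := h.norm_add_pos hC
  have p2 := h.swap'.norm_add_pos hC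
  have e := inner_sphMidpoint_sphMidpoint h.norm₁ p1 p2
  have n1 := norm_add_sq_of_unit h.norm₁ h.norm₂
  have n2 := norm_add_sq_of_unit h.norm₁ h.norm₃
  have g1 := h.le₁₂
  have g2 := h.le₁₃
  have g3 := h.le₂₃
  have hC1 : C ≤ 1 := by
    have := real_inner_le_norm u v
    rw [h.norm₁, h.norm₂] at this
    linarith
  have hC2 : C' = 1 - (1 - C) / (2 * (1 + C)) := by field_simp; linarith
  set a : ℝ := inner ℝ u v
  set b : ℝ := inner ℝ u w
  set c : ℝ := inner ℝ v w
  set x := ‖u + v‖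
  set y := ‖u + w‖
  have hxy : 0 < x * y := mul_pos p1 p2
  have h3 : 2 * (1 + C) ≤ x * y := by
    refine le_of_sq_le_sq ?_ (by positivity)
    rw [mul_pow x, n1, n2]
    nlinarith
  have h4 : 1 - C ≤ (1 - C) / (2 * (1 + C)) * (x * y) := by
    rw [div_mul_eq_mul_div, le_div_iff₀ (by positivity)]
    nlinarith
  refine le_of_mul_le_mul_right ?_ hxy
  rw [e, hC2]
  nlinarith [sq_nonneg (x - y)]

/-- Edge bounds of the corner triangle of a dissection. -/
lemma corner (h : EdgeBounds C A u v w) (hC : 0 ≤ C) (hA' : 0 ≤ A')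
    (h2 : 2 * A' ^ 2 = 1 + A) (hC' : C' * (2 * (1 + C)) = 1 + 3 * C) :
    EdgeBounds C' A' u (sphMidpoint u v) (sphMidpoint u w) where
  norm₁ := h.norm₁
  norm₂ := norm_sphMidpoint (h.norm_add_pos hC)
  norm₃ := norm_sphMidpoint (h.swap'.norm_add_pos hC)
  le₁₂ := h.le_inner_midpoint hC hC'
  le₁₃ := h.swap'.le_inner_midpoint hC hC'
  le₂₃ := h.le_inner_midpoints hC hC'
  ge₁₂ := h.inner_midpoint_le hC hA' h2
  ge₁₃ := h.swap'.inner_midpoint_le hC hA' h2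
  ge₂₃ := h.inner_midpoints_le hC hA' h2

/-- Edge bounds of the central triangle of a dissection. -/
lemma central (h : EdgeBounds C A u v w) (hC : 0 ≤ C) (hA' : 0 ≤ A')
    (h2 : 2 * A' ^ 2 = 1 + A) (hC' : C' * (2 * (1 + C)) = 1 + 3 * C) :
    EdgeBounds C' A' (sphMidpoint u v) (sphMidpoint u w) (sphMidpoint v w) where
  norm₁ := norm_sphMidpoint (h.norm_add_pos hC)
  norm₂ := norm_sphMidpoint (h.swap'.norm_add_pos hC)
  norm₃ := norm_sphMidpoint (h.swap.swap'.norm_add_pos hC)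
  le₁₂ := h.le_inner_midpoints hC hC'
  le₁₃ := by rw [sphMidpoint_comm u v]; exact h.swap.le_inner_midpoints hC hC'
  le₂₃ := by
    rw [sphMidpoint_comm u w, sphMidpoint_comm v w]
    exact h.swap'.swap.swap'.swap'.le_inner_midpoints hC hC'
  ge₁₂ := h.inner_midpoints_le hC hA' h2
  ge₁₃ := by rw [sphMidpoint_comm u v]; exact h.swap.inner_midpoints_le hC hA' h2
  ge₂₃ := by
    rw [sphMidpoint_comm u w, sphMidpoint_comm v w]
    exact h.swap'.swap.swap'.swap'.inner_midpoints_le hC hA' h2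

end EdgeBounds

/-! ### Cones over spherical triangles -/

/-- The closed convex cone spanned by three vectors. -/
def coneOver (u v w : E3) : Set E3 :=
  {x | ∃ a b c : ℝ, 0 ≤ a ∧ 0 ≤ b ∧ 0 ≤ c ∧ x = a • u + b • v + c • w}

lemma coneOver_swap (u v w : E3) : coneOver u v w = coneOver v u w := by
  ext x
  constructor <;>
  · rintro ⟨a, b, c, ha, hb, hc, rfl⟩
    exact ⟨b, a, c, hb, ha, hc, by abel⟩

lemma norm_smul_sphMidpoint {u v : E3} (h : 0 < ‖u + v‖) :
    ‖u + v‖ • sphMidpoint u v = u + v := by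
  rw [sphMidpoint, smul_smul, mul_inv_cancel₀ h.ne', one_smul]

/-- In barycentric coordinates the dissection is the flat medial one: a corner is where one
coordinate is at least the sum of the other two, the central triangle is where none exceeds that
sum. -/
lemma mem_coneOver_corner {u v w : E3} (h1 : 0 < ‖u + v‖) (h2 : 0 < ‖u + w‖) {a b c : ℝ}
    (hb : 0 ≤ b) (hc : 0 ≤ c) (h : b + c ≤ a) :
    a • u + b • v + c • w ∈ coneOver u (sphMidpoint u v) (sphMidpoint u w) := by
  refine ⟨a - b - c, b * ‖u + v‖, c * ‖u + w‖, by linarith, by positivity, by positivity, ?_⟩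
  rw [mul_smul, mul_smul, norm_smul_sphMidpoint h1, norm_smul_sphMidpoint h2]
  module

lemma mem_coneOver_central {u v w : E3} (h1 : 0 < ‖u + v‖) (h2 : 0 < ‖u + w‖)
    (h3 : 0 < ‖v + w‖) {a b c : ℝ} (ha : a ≤ b + c) (hb : b ≤ a + c) (hc : c ≤ a + b) :
    a • u + b • v + c • w ∈
      coneOver (sphMidpoint u v) (sphMidpoint u w) (sphMidpoint v w) := by
  refine ⟨(a + b - c) / 2 * ‖u + v‖, (a + c - b) / 2 * ‖u + w‖, (b + c - a) / 2 * ‖v + w‖,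
    mul_nonneg (by linarith) h1.le, mul_nonneg (by linarith) h2.le,
    mul_nonneg (by linarith) h3.le, ?_⟩
  rw [mul_smul, mul_smul, mul_smul, norm_smul_sphMidpoint h1, norm_smul_sphMidpoint h2,
    norm_smul_sphMidpoint h3]
  module

/-- The circumscribed-circle bound: a unit vector in the cone over a triangle whose sides are at
most those of an equilateral triangle is as close to a vertex as the centre of the latter. -/
lemma EdgeBounds.exists_vertex_near {C A ρ : ℝ} {u v w x : E3} (h : EdgeBounds C A u v w)
    (hC1 : C ≤ 1) (hρC : ρ ^ 2 = (1 + 2 * C) / 3)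
    (hx : x ∈ coneOver u v w) (hx1 : ‖x‖ = 1) :
    ρ ≤ inner ℝ x u ∨ ρ ≤ inner ℝ x v ∨ ρ ≤ inner ℝ x w := by
  obtain ⟨a, b, c, ha, hb, hc, e⟩ := hx
  by_contra! hcon
  obtain ⟨c1, c2, c3⟩ := hcon
  have s1 : (inner ℝ x x : ℝ) = a * inner ℝ x u + b * inner ℝ x v + c * inner ℝ x w := by
    conv_lhs => rw [e, inner_add_left, inner_add_left, real_inner_smul_left, real_inner_smul_left,
      real_inner_smul_left, ← e]
    rw [real_inner_comm x u, real_inner_comm x v, real_inner_comm x w]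
  have s2 : (inner ℝ x x : ℝ) = a ^ 2 + b ^ 2 + c ^ 2 + 2 * a * b * inner ℝ u v
      + 2 * a * c * inner ℝ u w + 2 * b * c * inner ℝ v w := by
    rw [e]
    simp only [inner_add_left, inner_add_right, real_inner_smul_left, real_inner_smul_right,
      inner_self_of_unit h.norm₁, inner_self_of_unit h.norm₂, inner_self_of_unit h.norm₃,
      real_inner_comm u v,
      real_inner_comm u w, real_inner_comm v w]
    ring
  rw [real_inner_self_eq_norm_sq, hx1] at s1 s2
  have hs : 0 < a + b + c := by
    by_contra! hn
    have : a = 0 := by linarith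
    have : b = 0 := by linarith
    have : c = 0 := by linarith
    subst_vars
    norm_num at s1
  -- Every inner product in `‖x‖ ^ 2 = 1` is replaced by its lower bound `C`; the surplus over the
  -- square of the sum is the term `q` up to the factor `1 / 3`.
  have k1 : ((a + b + c) * ρ) ^ 2 ≤ 1 := by
    rw [mul_pow, hρC]
    have := mul_le_mul_of_nonneg_left h.le₁₂ (mul_nonneg ha hb)
    have := mul_le_mul_of_nonneg_left h.le₁₃ (mul_nonneg ha hc)
    have := mul_le_mul_of_nonneg_left h.le₂₃ (mul_nonneg hb hc)
    have q : 0 ≤ (1 - C) * ((a - b) ^ 2 + (a - c) ^ 2 + (b - c) ^ 2) :=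
      mul_nonneg (by linarith) (by positivity)
    nlinarith
  have k2 : (a + b + c) * ρ ≤ 1 := by
    nlinarith
  have k3 : 0 ≤ a * (ρ - inner ℝ x u) := mul_nonneg ha (by linarith)
  have k4 : 0 ≤ b * (ρ - inner ℝ x v) := mul_nonneg hb (by linarith)
  have k5 : 0 ≤ c * (ρ - inner ℝ x w) := mul_nonneg hc (by linarith)
  -- One positive weight makes the inequality strict: `1 < (a + b + c) * ρ`, against `k2`.
  have : 0 < a ∨ 0 < b ∨ 0 < c := by
    by_contra! hn
    linarith [hn.1, hn.2.1, hn.2.2]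
  rcases this with q | q | q
  · have := mul_pos q (by linarith : 0 < ρ - inner ℝ x u); linarith
  · have := mul_pos q (by linarith : 0 < ρ - inner ℝ x v); linarith
  · have := mul_pos q (by linarith : 0 < ρ - inner ℝ x w); linarith

/-! ### Hat functions on a tessellation -/

/-- The vertices of the triangles of a family. -/
def vertexSet (F : Set SphTriangle) : Set E3 := ⋃ T ∈ F, T.vertices

lemma mem_vertexSet {F : Set SphTriangle} {x : E3} :
    x ∈ vertexSet F ↔ ∃ T ∈ F, x = T.u₁ ∨ x = T.u₂ ∨ x = T.u₃ := by
  simp [vertexSet, SphTriangle.vertices]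

/-- The function is linear on the cone spanned by three vectors. -/
def LinearOnCone (h : E3 → ℝ) (u v w : E3) : Prop :=
  ∀ a b c : ℝ, 0 ≤ a → 0 ≤ b → 0 ≤ c → h (a • u + b • v + c • w) = a * h u + b * h v + c * h w

lemma LinearOnCone.swap {h : E3 → ℝ} {u v w : E3} (H : LinearOnCone h u v w) :
    LinearOnCone h v u w := fun a b c ha hb hc => by
  rw [add_comm (a • v), H b a c hb ha hc]; ring

lemma LinearOnCone.swap' {h : E3 → ℝ} {u v w : E3} (H : LinearOnCone h u v w) :
    LinearOnCone h u w v := fun a b c ha hb hc => by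
  rw [add_right_comm, H a c b ha hc hb]; ring

/-- The hat function of the vertex `p`: continuous, linear on each triangle, with value `1` at `p`
and `0` at the other vertices. -/
structure IsHat (F : Set SphTriangle) (p : E3) (h : E3 → ℝ) : Prop where
  continuous : Continuous h
  linear : ∀ T ∈ F, LinearOnCone h T.u₁ T.u₂ T.u₃
  self : h p = 1
  other : ∀ q ∈ vertexSet F, q ≠ p → h q = 0

/-- Every vertex of the family has a hat function. -/
def HasHats (F : Set SphTriangle) : Prop := ∀ p ∈ vertexSet F, ∃ h, IsHat F p h

/-! ### Linearity on the cones of a dissected triangle -/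

section profile

variable {H : E3 → ℝ} {φ : ℝ → ℝ → ℝ → ℝ} {u v w : E3}

/-- Up to positive factors the corner cone is spanned by `u`, `u + v`, `u + w`, and `a • u + b • (u
+ v) + c • (u + w)` has coordinates `(a + b + c, b, c)`. For the central cone they are `(a + b, a +
c, b + c)`. -/
lemma linearOnCone_corner (h1 : 0 < ‖u + v‖) (h2 : 0 < ‖u + w‖) {α β γ : ℝ}
    (hH : ∀ a b c : ℝ, 0 ≤ a → 0 ≤ b → 0 ≤ c → H (a • u + b • v + c • w) = φ a b c)
    (hφ : ∀ a b c : ℝ, 0 ≤ a → 0 ≤ b → 0 ≤ c → φ (a + b + c) b c = a * α + b * β + c * γ) :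
    LinearOnCone H u (sphMidpoint u v) (sphMidpoint u w) := by
  have key : ∀ a b c : ℝ, 0 ≤ a → 0 ≤ b → 0 ≤ c →
      H (a • u + b • sphMidpoint u v + c • sphMidpoint u w) =
        a * α + b * (‖u + v‖⁻¹ * β) + c * (‖u + w‖⁻¹ * γ) := by
    intro a b c ha hb hc
    have e : a • u + b • sphMidpoint u v + c • sphMidpoint u w =
        (a + b * ‖u + v‖⁻¹ + c * ‖u + w‖⁻¹) • u + (b * ‖u + v‖⁻¹) • v + (c * ‖u + w‖⁻¹) • w := by
      simp only [sphMidpoint]; module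
    rw [e, hH _ _ _ (by positivity) (by positivity) (by positivity),
      hφ _ _ _ ha (by positivity) (by positivity)]
    ring
  intro a b c ha hb hc
  have k1 := key 1 0 0 zero_le_one le_rfl le_rfl
  have k2 := key 0 1 0 le_rfl zero_le_one le_rfl
  have k3 := key 0 0 1 le_rfl le_rfl zero_le_one
  simp only [one_smul, zero_smul, add_zero, zero_add, one_mul, zero_mul] at k1 k2 k3
  rw [key a b c ha hb hc, k1, k2, k3]

lemma linearOnCone_central (h1 : 0 < ‖u + v‖) (h2 : 0 < ‖u + w‖) (h3 : 0 < ‖v + w‖)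
    {α β γ : ℝ}
    (hH : ∀ a b c : ℝ, 0 ≤ a → 0 ≤ b → 0 ≤ c → H (a • u + b • v + c • w) = φ a b c)
    (hφ : ∀ a b c : ℝ, 0 ≤ a → 0 ≤ b → 0 ≤ c →
      φ (a + b) (a + c) (b + c) = a * α + b * β + c * γ) :
    LinearOnCone H (sphMidpoint u v) (sphMidpoint u w) (sphMidpoint v w) := by
  have key : ∀ a b c : ℝ, 0 ≤ a → 0 ≤ b → 0 ≤ c →
      H (a • sphMidpoint u v + b • sphMidpoint u w + c • sphMidpoint v w) =
        a * (‖u + v‖⁻¹ * α) + b * (‖u + w‖⁻¹ * β) + c * (‖v + w‖⁻¹ * γ) := by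
    intro a b c ha hb hc
    have e : a • sphMidpoint u v + b • sphMidpoint u w + c • sphMidpoint v w =
        (a * ‖u + v‖⁻¹ + b * ‖u + w‖⁻¹) • u + (a * ‖u + v‖⁻¹ + c * ‖v + w‖⁻¹) • v
          + (b * ‖u + w‖⁻¹ + c * ‖v + w‖⁻¹) • w := by
      simp only [sphMidpoint]; module
    rw [e, hH _ _ _ (by positivity) (by positivity) (by positivity),
      hφ _ _ _ (by positivity) (by positivity) (by positivity)]
    ring
  intro a b c ha hb hc
  have k1 := key 1 0 0 zero_le_one le_rfl le_rfl
  have k2 := key 0 1 0 le_rfl zero_le_one le_rfl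
  have k3 := key 0 0 1 le_rfl le_rfl zero_le_one
  simp only [one_smul, zero_smul, add_zero, zero_add, one_mul, zero_mul] at k1 k2 k3
  rw [key a b c ha hb hc, k1, k2, k3]

end profile

/-- Three numbers that are all zero, or one of them is one and the others are zero. -/
def IsIndicator (p q r : ℝ) : Prop :=
  (p = 1 ∧ q = 0 ∧ r = 0) ∨ (p = 0 ∧ q = 1 ∧ r = 0) ∨ (p = 0 ∧ q = 0 ∧ r = 1) ∨
    (p = 0 ∧ q = 0 ∧ r = 0)

/-- The part of the hat function that stays at an old vertex, in barycentric coordinates. -/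
noncomputable def oldProfile (p q r a b c : ℝ) : ℝ := max 0 (2 * (a * p + b * q + c * r) - (a + b + c))

/-- The hat function of the midpoint of an edge, up to a factor, in barycentric coordinates. -/
noncomputable def midProfile (p q r p' q' r' a b c : ℝ) : ℝ :=
  max 0 (min (a * p + b * q + c * r) (min (a * p' + b * q' + c * r')
    (a * p + b * q + c * r + (a * p' + b * q' + c * r') - (a + b + c) / 2)))

lemma oldProfile_corner {p q r : ℝ} (h : IsIndicator p q r) {a b c : ℝ} (ha : 0 ≤ a)
    (hb : 0 ≤ b) (hc : 0 ≤ c) : oldProfile p q r (a + b + c) b c = a * p + b * 0 + c * 0 := by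
  unfold oldProfile
  rcases h with ⟨rfl, rfl, rfl⟩ | ⟨rfl, rfl, rfl⟩ | ⟨rfl, rfl, rfl⟩ | ⟨rfl, rfl, rfl⟩
  · rw [max_eq_right] <;> linarith
  all_goals rw [max_eq_left] <;> linarith

lemma oldProfile_central {p q r : ℝ} (h : IsIndicator p q r) {a b c : ℝ} (ha : 0 ≤ a)
    (hb : 0 ≤ b) (hc : 0 ≤ c) :
    oldProfile p q r (a + b) (a + c) (b + c) = a * 0 + b * 0 + c * 0 := by
  unfold oldProfile
  rcases h with ⟨rfl, rfl, rfl⟩ | ⟨rfl, rfl, rfl⟩ | ⟨rfl, rfl, rfl⟩ | ⟨rfl, rfl, rfl⟩ <;>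
  rw [max_eq_left] <;> linarith

/-- If the two hats sit at the first two vertices, the profile is the positive part of the minimum
of `a`, `b` and `(a + b - c) / 2`. It is the coordinate of the midpoint in the three subtriangles
that contain it and vanishes on the fourth. -/
lemma midProfile_corner {p q r p' q' r' : ℝ} (h : IsIndicator p q r) (h' : IsIndicator p' q' r')
    (hp : p * p' = 0) (hq : q * q' = 0) (hr : r * r' = 0) {a b c : ℝ}
    (ha : 0 ≤ a) (hb : 0 ≤ b) (hc : 0 ≤ c) :
    midProfile p q r p' q' r' (a + b + c) b c =
      a * 0 + b * (p * q' + q * p') + c * (p * r' + r * p') := by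
  unfold midProfile
  rcases h with ⟨rfl, rfl, rfl⟩ | ⟨rfl, rfl, rfl⟩ | ⟨rfl, rfl, rfl⟩ | ⟨rfl, rfl, rfl⟩ <;>
  rcases h' with ⟨rfl, rfl, rfl⟩ | ⟨rfl, rfl, rfl⟩ | ⟨rfl, rfl, rfl⟩ | ⟨rfl, rfl, rfl⟩ <;>
  first
  | (exfalso; linarith)
  | (simp only [mul_zero, mul_one, add_zero, zero_add, max_def, min_def]; split_ifs <;> linarith)

lemma midProfile_central {p q r p' q' r' : ℝ} (h : IsIndicator p q r)
    (h' : IsIndicator p' q' r')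
    (hp : p * p' = 0) (hq : q * q' = 0) (hr : r * r' = 0) {a b c : ℝ}
    (ha : 0 ≤ a) (hb : 0 ≤ b) (hc : 0 ≤ c) :
    midProfile p q r p' q' r' (a + b) (a + c) (b + c) =
      a * (p * q' + q * p') + b * (p * r' + r * p') + c * (q * r' + r * q') := by
  unfold midProfile
  rcases h with ⟨rfl, rfl, rfl⟩ | ⟨rfl, rfl, rfl⟩ | ⟨rfl, rfl, rfl⟩ | ⟨rfl, rfl, rfl⟩ <;>
  rcases h' with ⟨rfl, rfl, rfl⟩ | ⟨rfl, rfl, rfl⟩ | ⟨rfl, rfl, rfl⟩ | ⟨rfl, rfl, rfl⟩ <;>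
  first
  | (exfalso; linarith)
  | (simp only [mul_zero, mul_one, add_zero, zero_add, max_def, min_def]; split_ifs <;> linarith)

/-- A triangle of the family with its vertices in any order. -/
structure IsFace (F : Set SphTriangle) (C A : ℝ) (u v w : E3) : Prop where
  bounds : EdgeBounds C A u v w
  linear : ∀ h : E3 → ℝ, (∀ T ∈ F, LinearOnCone h T.u₁ T.u₂ T.u₃) → LinearOnCone h u v w
  mem₁ : u ∈ vertexSet F
  mem₂ : v ∈ vertexSet F
  mem₃ : w ∈ vertexSet F

namespace IsFace

variable {F : Set SphTriangle} {C A : ℝ} {u v w : E3}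

lemma swap (f : IsFace F C A u v w) : IsFace F C A v u w :=
  ⟨f.bounds.swap, fun h hh => (f.linear h hh).swap, f.mem₂, f.mem₁, f.mem₃⟩

lemma swap' (f : IsFace F C A u v w) : IsFace F C A u w v :=
  ⟨f.bounds.swap', fun h hh => (f.linear h hh).swap', f.mem₁, f.mem₃, f.mem₂⟩

lemma of_mem (hF : ∀ T ∈ F, EdgeBounds C A T.u₁ T.u₂ T.u₃) {T : SphTriangle} (hT : T ∈ F) :
    IsFace F C A T.u₁ T.u₂ T.u₃ :=
  ⟨hF T hT, fun _ hh => hh T hT, mem_vertexSet.2 ⟨T, hT, .inl rfl⟩,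
    mem_vertexSet.2 ⟨T, hT, .inr (.inl rfl)⟩, mem_vertexSet.2 ⟨T, hT, .inr (.inr rfl)⟩⟩

end IsFace

open Classical in
lemma IsHat.eq_ite {F : Set SphTriangle} {p q : E3} {h : E3 → ℝ} (hh : IsHat F p h)
    (hq : q ∈ vertexSet F) : h q = if q = p then 1 else 0 := by
  split_ifs with e
  · rw [e, hh.self]
  · exact hh.other q hq e

lemma IsHat.eq_of_ne_zero {F : Set SphTriangle} {p q : E3} {h : E3 → ℝ} (hh : IsHat F p h)
    (hq : q ∈ vertexSet F) (h0 : h q ≠ 0) : q = p := by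
  by_contra e
  exact h0 (hh.other q hq e)

lemma IsFace.isIndicator {F : Set SphTriangle} {C A : ℝ} {u v w p : E3} {h : E3 → ℝ}
    (f : IsFace F C A u v w) (hA : A < 1) (hh : IsHat F p h) : IsIndicator (h u) (h v) (h w) := by
  have n1 := f.bounds.ne₁₂ hA
  have n2 := f.swap'.bounds.ne₁₂ hA
  have n3 := f.swap.swap'.bounds.ne₁₂ hA
  rw [hh.eq_ite f.mem₁, hh.eq_ite f.mem₂, hh.eq_ite f.mem₃]
  unfold IsIndicator
  split_ifs <;> simp_all

/-- The hat of `u` is nonzero at the midpoint, so a midpoint that is an old vertex must be `u`; by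
symmetry it must also be `v`. -/
lemma IsFace.sphMidpoint_notMem {F : Set SphTriangle} {C A : ℝ} {u v w : E3}
    (f : IsFace F C A u v w) (hC : 0 ≤ C) (hA : A < 1) (hF : HasHats F) :
    sphMidpoint u v ∉ vertexSet F := by
  have key : ∀ {u v w : E3}, IsFace F C A u v w → sphMidpoint u v ∈ vertexSet F →
      sphMidpoint u v = u := by
    intro u v w f hm
    obtain ⟨h, hh⟩ := hF u f.mem₁
    have hn := f.bounds.norm_add_pos hC
    have l := f.linear h hh.linear (‖u + v‖⁻¹) (‖u + v‖⁻¹) 0 (by positivity) (by positivity) le_rfl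
    rw [hh.self, hh.other v f.mem₂ (f.bounds.ne₁₂ hA).symm, zero_smul, add_zero, ← smul_add] at l
    apply hh.eq_of_ne_zero hm
    rw [sphMidpoint, l]
    simp [hn.ne']
  intro hm
  apply f.bounds.ne₁₂ hA
  rw [← key f hm, sphMidpoint_comm, key f.swap (by rwa [sphMidpoint_comm])]

/-- The triangles of a dissected family. -/
lemma exists_face_of_mem_dissectAll {F : Set SphTriangle} {C A : ℝ}
    (hF : ∀ T ∈ F, EdgeBounds C A T.u₁ T.u₂ T.u₃) {S : SphTriangle} (hS : S ∈ dissectAll F)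
    {P : E3 → E3 → E3 → Prop} (hP : ∀ u v w, P u v w → P v u w)
    (h1 : ∀ u v w, IsFace F C A u v w → P u (sphMidpoint u v) (sphMidpoint u w))
    (h2 : ∀ u v w, IsFace F C A u v w →
      P (sphMidpoint u v) (sphMidpoint u w) (sphMidpoint v w)) : P S.u₁ S.u₂ S.u₃ := by
  simp only [dissectAll, Set.mem_iUnion, SphTriangle.dissect, Set.mem_insert_iff,
    Set.mem_singleton_iff] at hS
  obtain ⟨T, hT, hS⟩ := hS
  have f := IsFace.of_mem hF hT
  rcases hS with rfl | rfl | rfl | rfl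
  · exact h1 _ _ _ f
  · have := hP _ _ _ (h1 _ _ _ f.swap)
    rwa [sphMidpoint_comm T.u₂ T.u₁] at this
  · have := h1 _ _ _ f.swap'.swap
    rwa [sphMidpoint_comm T.u₃ T.u₁, sphMidpoint_comm T.u₃ T.u₂] at this
  · exact h2 _ _ _ f

lemma exists_face_of_mem_vertexSet_dissectAll {F : Set SphTriangle} {C A : ℝ}
    (hF : ∀ T ∈ F, EdgeBounds C A T.u₁ T.u₂ T.u₃) {q : E3} (hq : q ∈ vertexSet (dissectAll F)) :
    q ∈ vertexSet F ∨ ∃ u v w, IsFace F C A u v w ∧ q = sphMidpoint u v := by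
  obtain ⟨S, hS, hq⟩ := mem_vertexSet.1 hq
  have := exists_face_of_mem_dissectAll hF hS
    (P := fun u v w => (q = u ∨ q = v ∨ q = w) →
      (q ∈ vertexSet F ∨ ∃ u v w, IsFace F C A u v w ∧ q = sphMidpoint u v))
    (fun u v w h hq => h (by tauto))
    (by
      rintro u v w f (rfl | rfl | rfl)
      · exact .inl f.mem₁
      · exact .inr ⟨u, v, w, f, rfl⟩
      · exact .inr ⟨u, w, v, f.swap', rfl⟩)
    (by
      rintro u v w f (rfl | rfl | rfl)
      · exact .inr ⟨u, v, w, f, rfl⟩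
      · exact .inr ⟨u, w, v, f.swap', rfl⟩
      · exact .inr ⟨v, w, u, f.swap.swap', rfl⟩)
  exact this hq

lemma vertexSet_subset_dissectAll (F : Set SphTriangle) :
    vertexSet F ⊆ vertexSet (dissectAll F) := by
  intro q hq
  obtain ⟨T, hT, hq⟩ := mem_vertexSet.1 hq
  have hmem : ∀ S ∈ T.dissect, S ∈ dissectAll F := fun S hS => Set.mem_biUnion hT hS
  rcases hq with rfl | rfl | rfl
  · exact mem_vertexSet.2 ⟨_, hmem ⟨T.u₁, _, _⟩ (.inl rfl), .inl rfl⟩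
  · exact mem_vertexSet.2 ⟨_, hmem ⟨_, T.u₂, _⟩ (.inr (.inl rfl)), .inr (.inl rfl)⟩
  · exact mem_vertexSet.2 ⟨_, hmem ⟨T.u₃, _, _⟩ (.inr (.inr (.inl rfl))), .inl rfl⟩

lemma sphMidpoint_mem_dissectAll {F : Set SphTriangle} {T : SphTriangle} (hT : T ∈ F) :
    sphMidpoint T.u₁ T.u₂ ∈ vertexSet (dissectAll F) :=
  mem_vertexSet.2 ⟨⟨T.u₁, _, _⟩, Set.mem_biUnion hT (.inl rfl), .inr (.inl rfl)⟩

/-- The piecewise linear function with value `1` at every vertex. -/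
lemma HasHats.exists_sum {F : Set SphTriangle} (hF : HasHats F) (hfin : (vertexSet F).Finite) :
    ∃ N : E3 → ℝ, Continuous N ∧ (∀ T ∈ F, LinearOnCone N T.u₁ T.u₂ T.u₃) ∧
      ∀ q ∈ vertexSet F, N q = 1 := by
  classical
  choose! h hh using hF
  have hmem : ∀ {p}, p ∈ hfin.toFinset → p ∈ vertexSet F := fun hp => hfin.mem_toFinset.1 hp
  refine ⟨fun x => ∑ p ∈ hfin.toFinset, h p x,
    continuous_finsetSum _ fun p hp => (hh p (hmem hp)).continuous, ?_, ?_⟩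
  · intro T hT a b c ha hb hc
    simp only [Finset.mul_sum, ← Finset.sum_add_distrib]
    exact Finset.sum_congr rfl fun p hp => (hh p (hmem hp)).linear T hT a b c ha hb hc
  · intro q hq
    have : ∀ p ∈ hfin.toFinset, h p q = if q = p then 1 else 0 :=
      fun p hp => (hh p (hmem hp)).eq_ite hq
    change ∑ p ∈ hfin.toFinset, h p q = 1
    rw [Finset.sum_congr rfl this]
    simp [hq]

/-! ### Hat functions of the dissected family -/

section step

variable {F : Set SphTriangle} {C A : ℝ} {p : E3} {h N : E3 → ℝ}

/-- `N` is the sum of the barycentric coordinates. If `a` is the coordinate of `p`, then `2 * h - N`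
is `a - b - c`, the coordinate of `p` in its corner triangle and nonpositive on the other three. -/
lemma isHat_old (hC : 0 ≤ C) (hA : A < 1)
    (hF : ∀ T ∈ F, EdgeBounds C A T.u₁ T.u₂ T.u₃)
    (hN : Continuous N) (hN' : ∀ T ∈ F, LinearOnCone N T.u₁ T.u₂ T.u₃)
    (hN1 : ∀ q ∈ vertexSet F, N q = 1) (hp : p ∈ vertexSet F) (hh : IsHat F p h) :
    IsHat (dissectAll F) p (fun x => max 0 (2 * h x - N x)) := by
  have hH : ∀ {u v w : E3}, IsFace F C A u v w → ∀ a b c : ℝ, 0 ≤ a → 0 ≤ b → 0 ≤ c →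
      (fun x => max 0 (2 * h x - N x)) (a • u + b • v + c • w) =
        oldProfile (h u) (h v) (h w) a b c := by
    intro u v w f a b c ha hb hc
    simp only [oldProfile, f.linear h hh.linear a b c ha hb hc, f.linear N hN' a b c ha hb hc,
      hN1 u f.mem₁, hN1 v f.mem₂, hN1 w f.mem₃, mul_one]
  refine ⟨by have := hh.continuous; fun_prop, ?_, ?_, ?_⟩
  · intro S hS
    apply exists_face_of_mem_dissectAll hF hS (fun _ _ _ h => h.swap)
    · intro u v w f
      exact linearOnCone_corner (f.bounds.norm_add_pos hC) (f.swap'.bounds.norm_add_pos hC)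
        (hH f) fun a b c => oldProfile_corner (f.isIndicator hA hh)
    · intro u v w f
      exact linearOnCone_central (f.bounds.norm_add_pos hC) (f.swap'.bounds.norm_add_pos hC)
        (f.swap.swap'.bounds.norm_add_pos hC)
        (hH f) fun a b c => oldProfile_central (f.isIndicator hA hh)
  · simp only [hh.self, hN1 p hp]
    norm_num
  · intro q hq hqp
    rcases exists_face_of_mem_vertexSet_dissectAll hF hq with hq | ⟨u, v, w, f, rfl⟩
    · simp only [hh.other q hq hqp, hN1 q hq]
      norm_num
    -- The midpoint has central coordinates `(‖u + v‖⁻¹, 0, 0)`; the zero summands give the shape of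
    -- `oldProfile_central`.
    · have e : sphMidpoint u v = (‖u + v‖⁻¹ + 0) • u + (‖u + v‖⁻¹ + 0) • v
          + ((0 : ℝ) + 0) • w := by simp [sphMidpoint]
      have hn := f.bounds.norm_add_pos hC
      have := hH f (‖u + v‖⁻¹ + 0) (‖u + v‖⁻¹ + 0) (0 + 0) (by positivity) (by positivity)
        (by simp)
      rw [oldProfile_central (f.isIndicator hA hh) (by positivity) le_rfl le_rfl, ← e] at this
      simpa using this

/-- The factor `‖a + b‖` normalises the value at the midpoint, where both old hats equal `‖a +
b‖⁻¹`. -/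
lemma isHat_midpoint {a b c : E3} {h' : E3 → ℝ} (hC : 0 ≤ C) (hA : A < 1)
    (hF : ∀ T ∈ F, EdgeBounds C A T.u₁ T.u₂ T.u₃)
    (hN : Continuous N) (hN' : ∀ T ∈ F, LinearOnCone N T.u₁ T.u₂ T.u₃)
    (hN1 : ∀ q ∈ vertexSet F, N q = 1) (fab : IsFace F C A a b c)
    (hh : IsHat F a h) (hh' : IsHat F b h') :
    IsHat (dissectAll F) (sphMidpoint a b)
      (fun x => ‖a + b‖ * max 0 (min (h x) (min (h' x) (h x + h' x - N x / 2)))) := by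
  have hab := fab.bounds.ne₁₂ hA
  have hnab := fab.bounds.norm_add_pos hC
  have hH : ∀ {u v w : E3}, IsFace F C A u v w → ∀ r s t : ℝ, 0 ≤ r → 0 ≤ s → 0 ≤ t →
      (fun x => ‖a + b‖ * max 0 (min (h x) (min (h' x) (h x + h' x - N x / 2))))
        (r • u + s • v + t • w) =
        ‖a + b‖ * midProfile (h u) (h v) (h w) (h' u) (h' v) (h' w) r s t := by
    intro u v w f r s t hr hs ht
    simp only [midProfile, f.linear h hh.linear r s t hr hs ht,
      f.linear h' hh'.linear r s t hr hs ht, f.linear N hN' r s t hr hs ht,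
      hN1 u f.mem₁, hN1 v f.mem₂, hN1 w f.mem₃, mul_one]
  have hprod : ∀ q ∈ vertexSet F, h q * h' q = 0 := by
    intro q hq
    by_cases e : q = a
    · rw [hh'.other q hq (e ▸ hab), mul_zero]
    · rw [hh.other q hq e, zero_mul]
  have hmid : ∀ {u v w : E3}, IsFace F C A u v w →
      ‖a + b‖ * max 0 (min (h (sphMidpoint u v)) (min (h' (sphMidpoint u v))
        (h (sphMidpoint u v) + h' (sphMidpoint u v) - N (sphMidpoint u v) / 2))) =
      ‖a + b‖ * (‖u + v‖⁻¹ * (h u * h' v + h v * h' u)) := by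
    intro u v w f
    have e : sphMidpoint u v = (‖u + v‖⁻¹ + 0) • u + (‖u + v‖⁻¹ + 0) • v
        + ((0 : ℝ) + 0) • w := by simp [sphMidpoint]
    have hn := f.bounds.norm_add_pos hC
    have := hH f (‖u + v‖⁻¹ + 0) (‖u + v‖⁻¹ + 0) (0 + 0) (by positivity) (by positivity)
      (by simp)
    rw [midProfile_central (f.isIndicator hA hh) (f.isIndicator hA hh') (hprod u f.mem₁)
      (hprod v f.mem₂) (hprod w f.mem₃) (by positivity) le_rfl le_rfl, ← e] at this
    simpa using this
  refine ⟨by have := hh.continuous; have := hh'.continuous; fun_prop, ?_, ?_, ?_⟩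
  · intro S hS
    apply exists_face_of_mem_dissectAll hF hS (fun _ _ _ h => h.swap)
    · intro u v w f
      refine linearOnCone_corner (f.bounds.norm_add_pos hC) (f.swap'.bounds.norm_add_pos hC)
        (α := 0) (β := ‖a + b‖ * (h u * h' v + h v * h' u))
        (γ := ‖a + b‖ * (h u * h' w + h w * h' u))
        (hH f) fun r s t hr hs ht => ?_
      rw [midProfile_corner (f.isIndicator hA hh) (f.isIndicator hA hh') (hprod u f.mem₁)
        (hprod v f.mem₂) (hprod w f.mem₃) hr hs ht]
      ring
    · intro u v w f
      refine linearOnCone_central (f.bounds.norm_add_pos hC) (f.swap'.bounds.norm_add_pos hC)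
        (f.swap.swap'.bounds.norm_add_pos hC)
        (α := ‖a + b‖ * (h u * h' v + h v * h' u)) (β := ‖a + b‖ * (h u * h' w + h w * h' u))
        (γ := ‖a + b‖ * (h v * h' w + h w * h' v))
        (hH f) fun r s t hr hs ht => ?_
      rw [midProfile_central (f.isIndicator hA hh) (f.isIndicator hA hh') (hprod u f.mem₁)
        (hprod v f.mem₂) (hprod w f.mem₃) hr hs ht]
      ring
  · rw [hmid fab, hh.self, hh'.self, hh.other b fab.mem₂ hab.symm]
    field_simp
    simp
  · intro q hq hqp
    rcases exists_face_of_mem_vertexSet_dissectAll hF hq with hq | ⟨u, v, w, f, rfl⟩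
    · have : min (h q) (min (h' q) (h q + h' q - N q / 2)) ≤ 0 := by
        by_cases e : q = a
        · rw [hh'.other q hq (e ▸ hab)]
          exact (min_le_right _ _).trans (min_le_left _ _)
        · rw [hh.other q hq e]
          exact min_le_left _ _
      rw [max_eq_left this, mul_zero]
    · rw [hmid f]
      have h1 : h u * h' v = 0 := by
        by_contra h0
        apply hqp
        rw [hh.eq_of_ne_zero f.mem₁ (left_ne_zero_of_mul h0),
          hh'.eq_of_ne_zero f.mem₂ (right_ne_zero_of_mul h0)]
      have h2 : h v * h' u = 0 := by
        by_contra h0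
        apply hqp
        rw [hh.eq_of_ne_zero f.mem₂ (left_ne_zero_of_mul h0),
          hh'.eq_of_ne_zero f.mem₁ (right_ne_zero_of_mul h0), sphMidpoint_comm]
      rw [h1, h2]
      simp

lemma HasHats.dissectAll (hC : 0 ≤ C) (hA : A < 1)
    (hF : ∀ T ∈ F, EdgeBounds C A T.u₁ T.u₂ T.u₃) (hats : HasHats F)
    (hfin : (vertexSet F).Finite) : HasHats (dissectAll F) := by
  obtain ⟨N, hN, hN', hN1⟩ := hats.exists_sum hfin
  intro q hq
  rcases exists_face_of_mem_vertexSet_dissectAll hF hq with hq | ⟨u, v, w, f, rfl⟩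
  · obtain ⟨h, hh⟩ := hats q hq
    exact ⟨_, isHat_old hC hA hF hN hN' hN1 hq hh⟩
  · obtain ⟨h, hh⟩ := hats u f.mem₁
    obtain ⟨h', hh'⟩ := hats v f.mem₂
    exact ⟨_, isHat_midpoint hC hA hF hN hN' hN1 f hh hh'⟩

end step

lemma vertexSet_ssubset_dissectAll {F : Set SphTriangle} {C A : ℝ} (hC : 0 ≤ C) (hA : A < 1)
    (hF : ∀ T ∈ F, EdgeBounds C A T.u₁ T.u₂ T.u₃) (hats : HasHats F) (hne : F.Nonempty) :
    vertexSet F ⊂ vertexSet (dissectAll F) := by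
  refine (Set.ssubset_iff_of_subset (vertexSet_subset_dissectAll F)).2 ?_
  obtain ⟨T, hT⟩ := hne
  exact ⟨_, sphMidpoint_mem_dissectAll hT,
    (IsFace.of_mem hF hT).sphMidpoint_notMem hC hA hats⟩

/-! ### Separation of the vertices of a tessellation -/

open Filter Topology in
/-- A continuous function that is Lipschitz on each of finitely many sets covering the space is
Lipschitz. -/
lemma sub_le_of_lipschitzOnWith_cover {E ι : Type*} [NormedAddCommGroup E] [NormedSpace ℝ E]
    {I : Set ι} (hI : I.Finite) {S : ι → Set E} (hS : ∀ x, ∃ i ∈ I, x ∈ S i) {f : E → ℝ}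
    (hf : Continuous f) {K : NNReal} (hK : ∀ i ∈ I, LipschitzOnWith K f (S i)) (x y : E) :
    f y - f x ≤ K * ‖y - x‖ := by
  set γ : ℝ → E := fun t => x + t • (y - x) with hγ
  have hγc : Continuous γ := by fun_prop
  have hd : ∀ t z, dist (γ z) (γ t) = |z - t| * ‖y - x‖ := by
    intro t z
    rw [dist_eq_norm, hγ]
    simp only [add_sub_add_left_eq_sub, ← sub_smul, norm_smul, Real.norm_eq_abs]
  have main := image_le_of_liminf_slope_right_le_deriv_boundary (f := f ∘ γ) (a := 0) (b := 1)
    (B := fun t => f x + K * ‖y - x‖ * t) (B' := fun _ => K * ‖y - x‖)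
    (hf.comp hγc).continuousOn (by simp [hγ]) (by fun_prop)
    (fun t _ => by
      have := ((hasDerivAt_id t).const_mul (K * ‖y - x‖)).const_add (f x)
      simpa using this.hasDerivWithinAt) ?_ (Set.right_mem_Icc.2 zero_le_one)
  · simp only [hγ, Function.comp_apply, one_smul, add_sub_cancel, mul_one] at main
    linarith
  · intro t _ r hr
    -- The comparison theorem needs small right slopes only frequently. By pigeonhole one `S i`
    -- contains `γ z` for `z` arbitrarily close to `t` from the right, and then `γ t` lies in its
    -- closure, where the Lipschitz bound persists.
    have h1 : ∃ᶠ z in 𝓝[>] t, ∃ i ∈ I, γ z ∈ S i :=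
      (Eventually.of_forall fun z => hS (γ z)).frequently
    obtain ⟨i, hi, h3⟩ := (frequently_exists_finite hI).1 h1
    have hcl : LipschitzOnWith K f (closure (S i)) :=
      (lipschitzOnWith_closure_iff hf.continuousOn).2 (hK i hi)
    have ht : γ t ∈ closure (S i) := by
      rw [mem_closure_iff_frequently]
      exact ((hγc.tendsto t).mono_left nhdsWithin_le_nhds).frequently h3
    refine (h3.and_eventually self_mem_nhdsWithin).mono fun z ⟨hz, htz⟩ => ?_
    have htz : 0 < z - t := sub_pos.2 htz
    have := hcl.dist_le_mul _ (subset_closure hz) _ ht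
    rw [hd, Real.dist_eq, abs_of_pos htz] at this
    refine lt_of_le_of_lt ?_ hr
    rw [slope_def_field, div_le_iff₀ htz]
    have h5 := le_abs_self (f (γ z) - f (γ t))
    simp only [Function.comp_apply]
    nlinarith

/-! ### Barycentric coordinates in nearly equilateral triangles -/

namespace EdgeBounds

variable {C A : ℝ} {u v w : E3}

/-- The Gram determinant over `1 - inner ℝ v w ^ 2` is the squared distance of `u` from the plane of
`v` and `w`; it has to be at least `(1 - A) / 2`. A flat triangle would fail, so `hCA` bounds the
ratio of squared chords by `8 / 5`. -/
lemma det_ge (h : EdgeBounds C A u v w) (hA : A < 1) (hA0 : 11 / 25 ≤ A)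
    (hCA : 5 * (1 - C) ≤ 8 * (1 - A)) :
    (1 - A) * (1 - inner ℝ v w ^ 2) ≤ 2 * (1 + 2 * inner ℝ u v * inner ℝ u w * inner ℝ v w
      - inner ℝ u v ^ 2 - inner ℝ u w ^ 2 - inner ℝ v w ^ 2) := by
  have g1 := h.le₁₂
  have g2 := h.le₁₃
  have g3 := h.le₂₃
  have g4 := h.ge₁₂
  have g5 := h.ge₁₃
  have g6 := h.ge₂₃
  have hs : 0 < 1 - A := by linarith
  obtain ⟨s, es⟩ : ∃ s, s = 1 - A := ⟨_, rfl⟩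
  -- `x` is the relative excess of a squared chord over the smallest one allowed; `3 / 5` is `8 / 5
  -- - 1`.
  have ex : ∀ g : ℝ, C ≤ g → g ≤ A → ∃ x, 0 ≤ x ∧ x ≤ 3 / 5 ∧ g = 1 - s * (1 + x) := by
    intro g h1 h2
    rw [← es] at hs
    refine ⟨(1 - g) / s - 1, ?_, ?_, by field_simp; ring⟩
    · rw [sub_nonneg, le_div_iff₀ hs]; linarith
    · rw [sub_le_iff_le_add, div_le_iff₀ hs]; linarith
  obtain ⟨x, x0, x1, ea⟩ := ex _ g1 g4
  obtain ⟨y, y0, y1, eb⟩ := ex _ g2 g5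
  obtain ⟨z, z0, z1, ec⟩ := ex _ g3 g6
  rw [ea, eb, ec, ← es]
  have s0 : 0 < s := by linarith
  have s1 : s ≤ 14 / 25 := by linarith
  have key : 0 ≤ 2 * (3 + 2 * (x + y + z) + 2 * (x * y + x * z + y * z) - x ^ 2 - y ^ 2 - z ^ 2)
      - 4 * s * ((1 + x) * (1 + y) * (1 + z)) - (1 + z) * (2 - s * (1 + z)) := by
    have k1 : 4 * s * ((1 + x) * (1 + y) * (1 + z)) ≤
        4 * (14 / 25) * ((1 + x) * (1 + y) * (1 + z)) := by gcongr
    have k2 : (1 + z) * (2 - s * (1 + z)) ≤ 2 * (1 + z) := by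
      have : 0 ≤ s * (1 + z) ^ 2 := by positivity
      linarith
    have k3 : x * x ≤ x * (3 / 5) := by gcongr
    have k4 : y * y ≤ y * (3 / 5) := by gcongr
    have k5 : z * z ≤ z * (3 / 5) := by gcongr
    have k6 : x * y * z ≤ x * y * (3 / 5) := by gcongr
    have k7 : 0 ≤ x * y := by positivity
    have k8 : 0 ≤ x * z := by positivity
    have k9 : 0 ≤ y * z := by positivity
    linarith
  have := mul_nonneg (sq_nonneg s) key
  linarith

/-- A barycentric coordinate is bounded by the norm. -/
lemma sq_coord_le (h : EdgeBounds C A u v w) (hA : A < 1) (hA0 : 11 / 25 ≤ A) (hC : 0 ≤ C)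
    (hCA : 5 * (1 - C) ≤ 8 * (1 - A)) (a b c : ℝ) :
    a ^ 2 * (1 - A) ≤ 2 * ‖a • u + b • v + c • w‖ ^ 2 := by
  have d := h.det_ge hA hA0 hCA
  have e : ‖a • u + b • v + c • w‖ ^ 2 = a ^ 2 + b ^ 2 + c ^ 2 + 2 * a * b * inner ℝ u v
      + 2 * a * c * inner ℝ u w + 2 * b * c * inner ℝ v w := by
    rw [← real_inner_self_eq_norm_sq]
    simp only [inner_add_left, inner_add_right, real_inner_smul_left, real_inner_smul_right,
      inner_self_of_unit h.norm₁, inner_self_of_unit h.norm₂, inner_self_of_unit h.norm₃,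
      real_inner_comm u v, real_inner_comm u w, real_inner_comm v w]
    ring
  rw [e]
  have g3 := h.le₂₃
  have g6 := h.ge₂₃
  set x : ℝ := inner ℝ u v
  set y : ℝ := inner ℝ u w
  set z : ℝ := inner ℝ v w
  have hz : 0 < 1 - z ^ 2 := by nlinarith
  refine le_of_mul_le_mul_right ?_ hz
  set P := a * x + b + c * z with hP
  set R := a * y + b * z + c with hR
  -- Pythagoras: `P` and `R` are the inner products of the vector with `v` and `w`, so the last
  -- bracket is its in-plane part and the determinant term the orthogonal one.
  have id1 : (1 - z ^ 2) * (a ^ 2 + b ^ 2 + c ^ 2 + 2 * a * b * x + 2 * a * c * y + 2 * b * c * z)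
      = (1 + 2 * x * y * z - x ^ 2 - y ^ 2 - z ^ 2) * a ^ 2 + (P ^ 2 + R ^ 2 - 2 * z * P * R) := by
    rw [hP, hR]; ring
  have k1 : 0 ≤ P ^ 2 + R ^ 2 - 2 * z * P * R := by
    nlinarith [sq_nonneg (P - z * R), mul_nonneg hz.le (sq_nonneg R)]
  nlinarith [mul_le_mul_of_nonneg_right d (sq_nonneg a)]

lemma abs_coord_le (h : EdgeBounds C A u v w) (hA : A < 1) (hA0 : 11 / 25 ≤ A) (hC : 0 ≤ C)
    (hCA : 5 * (1 - C) ≤ 8 * (1 - A)) (a b c : ℝ) :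
    |a| ≤ √(2 / (1 - A)) * ‖a • u + b • v + c • w‖ := by
  have hs : 0 < 1 - A := by linarith
  refine abs_le_of_sq_le_sq ?_ (by positivity)
  rw [mul_pow, Real.sq_sqrt (by positivity), div_mul_eq_mul_div, le_div_iff₀ hs]
  exact h.sq_coord_le hA hA0 hC hCA a b c

end EdgeBounds

/-- The family covers the space by the cones over its triangles. -/
def Covers (F : Set SphTriangle) : Prop := ∀ x : E3, ∃ T ∈ F, x ∈ coneOver T.u₁ T.u₂ T.u₃

lemma inner_le_of_hasHats {F : Set SphTriangle} {C A : ℝ} (hfin : F.Finite) (hats : HasHats F)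
    (hcov : Covers F) (hF : ∀ T ∈ F, EdgeBounds C A T.u₁ T.u₂ T.u₃) (hA : A < 1)
    (hA0 : 11 / 25 ≤ A) (hC : 0 ≤ C) (hCA : 5 * (1 - C) ≤ 8 * (1 - A)) {p q : E3}
    (hp : p ∈ vertexSet F) (hq : q ∈ vertexSet F) (hpq : p ≠ q) : inner ℝ p q ≤ A := by
  by_cases hT : ∃ T ∈ F, p ∈ T.vertices ∧ q ∈ T.vertices
  · obtain ⟨T, hT, h1, h2⟩ := hT
    have b := hF T hT
    simp only [SphTriangle.vertices, Set.mem_insert_iff, Set.mem_singleton_iff] at h1 h2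
    rcases h1 with rfl | rfl | rfl <;> rcases h2 with rfl | rfl | rfl <;>
      first
      | exact absurd rfl hpq
      | exact b.ge₁₂
      | exact b.ge₁₃
      | exact b.ge₂₃
      | exact b.swap.ge₁₂
      | exact b.swap'.swap.ge₁₂
      | exact b.swap'.ge₂₃
  push Not at hT
  obtain ⟨h, hh⟩ := hats p hp
  obtain ⟨h', hh'⟩ := hats q hq
  have hs : 0 < 1 - A := by linarith
  have hnorm : ∀ {x}, x ∈ vertexSet F → ‖x‖ = 1 := by
    intro x hx
    obtain ⟨T, hT, rfl | rfl | rfl⟩ := mem_vertexSet.1 hx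
    exacts [(hF T hT).norm₁, (hF T hT).norm₂, (hF T hT).norm₃]
  have lip : ∀ T ∈ F, LipschitzOnWith (√(2 / (1 - A))).toNNReal (fun x => h x - h' x)
      (coneOver T.u₁ T.u₂ T.u₃) := by
    intro T hTF
    apply LipschitzOnWith.of_dist_le_mul
    rintro x ⟨a, b, c, ha, hb, hc, rfl⟩ y ⟨a', b', c', ha', hb', hc', rfl⟩
    rw [Real.coe_toNNReal _ (Real.sqrt_nonneg _), Real.dist_eq, dist_eq_norm]
    simp only [hh.linear T hTF a b c ha hb hc, hh.linear T hTF a' b' c' ha' hb' hc',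
      hh'.linear T hTF a b c ha hb hc, hh'.linear T hTF a' b' c' ha' hb' hc']
    have f := IsFace.of_mem hF hTF
    have i1 := f.isIndicator hA hh
    have i2 := f.isIndicator hA hh'
    have b1 := f.bounds.abs_coord_le hA hA0 hC hCA (a - a') (b - b') (c - c')
    have b2 := f.bounds.swap.abs_coord_le hA hA0 hC hCA (b - b') (a - a') (c - c')
    have b3 := f.bounds.swap'.swap.abs_coord_le hA hA0 hC hCA (c - c') (a - a') (b - b')
    have e1 : a • T.u₁ + b • T.u₂ + c • T.u₃ - (a' • T.u₁ + b' • T.u₂ + c' • T.u₃) =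
      (a - a') • T.u₁ + (b - b') • T.u₂ + (c - c') • T.u₃ := by module
    have e2 : (b - b') • T.u₂ + (a - a') • T.u₁ + (c - c') • T.u₃ =
      (a - a') • T.u₁ + (b - b') • T.u₂ + (c - c') • T.u₃ := by module
    have e3 : (c - c') • T.u₃ + (a - a') • T.u₁ + (b - b') • T.u₂ =
      (a - a') • T.u₁ + (b - b') • T.u₂ + (c - c') • T.u₃ := by module
    rw [e2] at b2
    rw [e3] at b3
    rw [e1]
    set n := √(2 / (1 - A)) * ‖(a - a') • T.u₁ + (b - b') • T.u₂ + (c - c') • T.u₃‖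
    have n0 : 0 ≤ n := by positivity
    -- No triangle contains both `p` and `q`, so at most one of the two hats is nonzero on this
    -- cone.
    have mem : ∀ x ∈ T.vertices, h x = 1 → ∀ y ∈ T.vertices, h' y = 1 → False := by
      intro x hx hx1 y hy hy1
      have hv : ∀ z ∈ T.vertices, z ∈ vertexSet F := fun z hz => Set.mem_biUnion hTF hz
      have ex := hh.eq_of_ne_zero (hv x hx) (by rw [hx1]; exact one_ne_zero)
      have ey := hh'.eq_of_ne_zero (hv y hy) (by rw [hy1]; exact one_ne_zero)
      exact hT T hTF (ex ▸ hx) (ey ▸ hy)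
    have m1 : T.u₁ ∈ T.vertices := by simp [SphTriangle.vertices]
    have m2 : T.u₂ ∈ T.vertices := by simp [SphTriangle.vertices]
    have m3 : T.u₃ ∈ T.vertices := by simp [SphTriangle.vertices]
    rw [abs_le] at b1 b2 b3 ⊢
    rcases i1 with ⟨q1, q2, q3⟩ | ⟨q1, q2, q3⟩ | ⟨q1, q2, q3⟩ | ⟨q1, q2, q3⟩ <;>
    rcases i2 with ⟨r1, r2, r3⟩ | ⟨r1, r2, r3⟩ | ⟨r1, r2, r3⟩ | ⟨r1, r2, r3⟩ <;>
    first
    | (exfalso; refine mem _ ?_ (by assumption) _ ?_ (by assumption) <;> assumption)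
    | (rw [q1, q2, q3, r1, r2, r3]; constructor <;> linarith)
  have main := sub_le_of_lipschitzOnWith_cover hfin hcov
    (hh.continuous.sub hh'.continuous) lip q p
  simp only [Pi.sub_apply] at main
  rw [Real.coe_toNNReal _ (Real.sqrt_nonneg _), hh.self, hh'.self, hh.other q hq hpq.symm,
    hh'.other p hp hpq] at main
  have e : ‖p - q‖ ^ 2 = 2 - 2 * inner ℝ p q := by
    rw [norm_sub_sq_real, hnorm hp, hnorm hq]; ring
  -- `main` reads `2 ≤ √(2 / (1 - A)) * ‖p - q‖`; squaring gives the claim.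
  have k := pow_le_pow_left₀ (by norm_num) main 2
  rw [mul_pow, Real.sq_sqrt (by positivity), e, div_mul_eq_mul_div, le_div_iff₀ hs] at k
  nlinarith

/-! ### The icosahedron -/

lemma inner_vec3 (a b c a' b' c' : ℝ) :
    inner ℝ (!₂[a, b, c] : E3) !₂[a', b', c'] = a * a' + b * b' + c * c' := by
  simp [PiLp.inner_apply, Fin.sum_univ_three]
  ring

lemma mul_eq_one_or_of_signs {s t : ℝ} (hs : s = 1 ∨ s = -1) (ht : t = 1 ∨ t = -1) :
    (s * t = 1 ∧ s = t) ∨ (s * t = -1 ∧ s = -t) := by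
  rcases hs with rfl | rfl <;> rcases ht with rfl | rfl <;> norm_num

lemma neg_vec3 (a b c : ℝ) : -(!₂[a, b, c] : E3) = !₂[-a, -b, -c] := by
  ext i; fin_cases i <;> simp

lemma mem_icosahedronRaw {w : E3} : w ∈ icosahedronRaw ↔
    ∃ s t : ℝ, (s = 1 ∨ s = -1) ∧ (t = 1 ∨ t = -1) ∧ (w = !₂[0, s, t * goldenRatio] ∨
      w = !₂[t * goldenRatio, 0, s] ∨ w = !₂[s, t * goldenRatio, 0]) := by
  simp only [icosahedronRaw, Set.mem_ofPred_eq, Set.mem_insert_iff, Set.mem_singleton_iff]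
  constructor
  · rintro ⟨s, hs, t, ht, h⟩; exact ⟨s, t, hs, ht, h⟩
  · rintro ⟨s, t, hs, ht, h⟩; exact ⟨s, hs, t, ht, h⟩

lemma inner_icosahedronRaw {w w' : E3} (h : w ∈ icosahedronRaw) (h' : w' ∈ icosahedronRaw) :
    w = w' ∨ w = -w' ∨ inner ℝ w w' = goldenRatio ∨ inner ℝ w w' = -goldenRatio := by
  obtain ⟨s, t, hs, ht, h⟩ := mem_icosahedronRaw.1 h
  obtain ⟨s', t', hs', ht', h'⟩ := mem_icosahedronRaw.1 h'
  have e := goldenRatio_sq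
  have k1 := mul_eq_one_or_of_signs hs hs'
  have k2 := mul_eq_one_or_of_signs ht ht'
  have k3 := mul_eq_one_or_of_signs hs ht'
  have k4 := mul_eq_one_or_of_signs ht hs'
  rcases h with rfl | rfl | rfl <;> rcases h' with rfl | rfl | rfl <;>
    simp only [inner_vec3, neg_vec3]
  all_goals first
    | (rcases k1 with ⟨k1, rfl⟩ | ⟨k1, rfl⟩ <;> rcases k2 with ⟨k2, rfl⟩ | ⟨k2, rfl⟩
       · left; rfl
       · right; right; right; linear_combination k1 + k2 * goldenRatio ^ 2 - e
       · right; right; left; linear_combination k1 + k2 * goldenRatio ^ 2 + e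
       · right; left; simp)
    | (rcases k3 with ⟨k, -⟩ | ⟨k, -⟩
       · right; right; left; linear_combination k * goldenRatio
       · right; right; right; linear_combination k * goldenRatio)
    | (rcases k4 with ⟨k, -⟩ | ⟨k, -⟩
       · right; right; left; linear_combination k * goldenRatio
       · right; right; right; linear_combination k * goldenRatio)

lemma norm_icosahedronRaw {w : E3} (h : w ∈ icosahedronRaw) : ‖w‖ = √(goldenRatio + 2) := by
  rw [norm_eq_sqrt_real_inner]
  congr 1
  obtain ⟨s, t, hs, ht, h⟩ := mem_icosahedronRaw.1 h
  have hs2 : s * s = 1 := by rcases hs with rfl | rfl <;> norm_num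
  have ht2 : t * t = 1 := by rcases ht with rfl | rfl <;> norm_num
  rcases h with rfl | rfl | rfl <;> rw [inner_vec3] <;>
    linear_combination hs2 + goldenRatio ^ 2 * ht2 + goldenRatio_sq

lemma neg_mem_icosahedronRaw {w : E3} (h : w ∈ icosahedronRaw) : -w ∈ icosahedronRaw := by
  obtain ⟨s, t, hs, ht, h⟩ := mem_icosahedronRaw.1 h
  refine mem_icosahedronRaw.2 ⟨-s, -t, by grind, by grind, ?_⟩
  rcases h with rfl | rfl | rfl <;> simp [neg_vec3]

lemma ncard_icosahedronRaw : icosahedronRaw.ncard = 12 := by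
  let sg : Bool → ℝ := fun b => if b then 1 else -1
  let f : Fin 3 × Bool × Bool → E3 := fun x =>
    ![!₂[0, sg x.2.1, sg x.2.2 * goldenRatio], !₂[sg x.2.2 * goldenRatio, 0, sg x.2.1],
      !₂[sg x.2.1, sg x.2.2 * goldenRatio, 0]] x.1
  have hf : Function.Injective f := by
    rintro ⟨i, s, t⟩ ⟨i', s', t'⟩ h
    have h0 : f (i, s, t) 0 = f (i', s', t') 0 := by rw [h]
    have h1 : f (i, s, t) 1 = f (i', s', t') 1 := by rw [h]
    have h2 : f (i, s, t) 2 = f (i', s', t') 2 := by rw [h]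
    have hφ := goldenRatio_pos
    have hsg : ∀ b, sg b ≠ 0 := by intro b; cases b <;> simp [sg]
    have hsi : ∀ b b', sg b = sg b' → b = b' := by
      intro b b'; cases b <;> cases b' <;> norm_num [sg]
    fin_cases i <;> fin_cases i' <;>
      simp [f, hφ.ne', hsg, eq_comm] at h0 h1 h2 ⊢
    all_goals constructor <;> apply hsi <;> simp_all
  have hr : icosahedronRaw = Set.range f := by
    ext w
    rw [mem_icosahedronRaw, Set.mem_range]
    constructor
    · rintro ⟨s, t, hs, ht, h⟩
      have e : ∀ s : ℝ, (s = 1 ∨ s = -1) → ∃ b, s = sg b := by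
        rintro s (rfl | rfl)
        · exact ⟨true, by simp [sg]⟩
        · exact ⟨false, by simp [sg]⟩
      obtain ⟨b, rfl⟩ := e s hs
      obtain ⟨b', rfl⟩ := e t ht
      rcases h with rfl | rfl | rfl
      · exact ⟨(0, b, b'), rfl⟩
      · exact ⟨(1, b, b'), rfl⟩
      · exact ⟨(2, b, b'), rfl⟩
    · rintro ⟨⟨i, b, b'⟩, rfl⟩
      have e : ∀ b, sg b = 1 ∨ sg b = -1 := by intro b; cases b <;> simp [sg]
      refine ⟨sg b, sg b', e b, e b', ?_⟩
      fin_cases i <;> simp [f]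
  rw [hr, ← Nat.card_coe_set_eq, Nat.card_range_of_injective hf]
  simp

lemma exists_sign_abs (y : ℝ) : ∃ e Y : ℝ, (e = 1 ∨ e = -1) ∧ 0 ≤ Y ∧ y = e * Y := by
  rcases le_total 0 y with h | h
  · exact ⟨1, y, .inl rfl, h, by ring⟩
  · exact ⟨-1, -y, .inr rfl, by linarith, by ring⟩

/-- After fixing signs, an octant consists of one whole face and halves of three faces that straddle
the coordinate planes. The tests `c1`, `c2`, `c3` ask whether `y` lies beyond an edge of the whole
face. -/
lemma exists_icosahedronRaw_cone (y : E3) :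
    ∃ u ∈ icosahedronRaw, ∃ v ∈ icosahedronRaw, ∃ w ∈ icosahedronRaw,
      inner ℝ u v = goldenRatio ∧ inner ℝ u w = goldenRatio ∧ inner ℝ v w = goldenRatio ∧
      y ∈ coneOver u v w := by
  obtain ⟨e₀, X, he₀, hX, h0⟩ := exists_sign_abs (y 0)
  obtain ⟨e₁, Y, he₁, hY, h1⟩ := exists_sign_abs (y 1)
  obtain ⟨e₂, Z, he₂, hZ, h2⟩ := exists_sign_abs (y 2)
  have hy : y = !₂[e₀ * X, e₁ * Y, e₂ * Z] := by
    ext i; fin_cases i <;> simp [h0, h1, h2]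
  have hφ := goldenRatio_pos
  have hφ2 := goldenRatio_sq
  set φ := goldenRatio
  have q0 : e₀ * e₀ = 1 := by rcases he₀ with rfl | rfl <;> norm_num
  have q1 : e₁ * e₁ = 1 := by rcases he₁ with rfl | rfl <;> norm_num
  have q2 : e₂ * e₂ = 1 := by rcases he₂ with rfl | rfl <;> norm_num
  have n0 : -e₀ = 1 ∨ -e₀ = -1 := by grind
  have n1 : -e₁ = 1 ∨ -e₁ = -1 := by grind
  have n2 : -e₂ = 1 ∨ -e₂ = -1 := by grind
  have mP : ∀ {s t : ℝ}, (s = 1 ∨ s = -1) → (t = 1 ∨ t = -1) →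
      (!₂[0, s, t * φ] : E3) ∈ icosahedronRaw :=
    fun hs ht => mem_icosahedronRaw.2 ⟨_, _, hs, ht, .inl rfl⟩
  have mQ : ∀ {s t : ℝ}, (s = 1 ∨ s = -1) → (t = 1 ∨ t = -1) →
      (!₂[t * φ, 0, s] : E3) ∈ icosahedronRaw :=
    fun hs ht => mem_icosahedronRaw.2 ⟨_, _, hs, ht, .inr (.inl rfl)⟩
  have mR : ∀ {s t : ℝ}, (s = 1 ∨ s = -1) → (t = 1 ∨ t = -1) →
      (!₂[s, t * φ, 0] : E3) ∈ icosahedronRaw :=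
    fun hs ht => mem_icosahedronRaw.2 ⟨_, _, hs, ht, .inr (.inr rfl)⟩
  have combo : ∀ {a b c x₀ x₁ x₂ y₀ y₁ y₂ z₀ z₁ z₂ : ℝ}, 0 ≤ a → 0 ≤ b → 0 ≤ c →
      e₀ * X = a * x₀ + b * y₀ + c * z₀ → e₁ * Y = a * x₁ + b * y₁ + c * z₁ →
      e₂ * Z = a * x₂ + b * y₂ + c * z₂ →
      y ∈ coneOver !₂[x₀, x₁, x₂] !₂[y₀, y₁, y₂] !₂[z₀, z₁, z₂] := by
    intro a b c _ _ _ _ _ _ _ _ _ ha hb hc k0 k1 k2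
    refine ⟨a, b, c, ha, hb, hc, ?_⟩
    rw [hy, k0, k1, k2]
    ext i; fin_cases i <;> simp
  by_cases c1 : X + φ ^ 2 * Y ≤ Z * φ
  · have p : X / φ + φ * Y ≤ Z := by
      rw [div_add' _ _ _ hφ.ne', div_le_iff₀ hφ]; linarith
    have p2 : Y ≤ (Z - X / φ) / φ := by rw [le_div_iff₀ hφ]; linarith
    refine ⟨_, mP he₁ he₂, _, mP n1 he₂, _, mQ he₂ he₀, ?_, ?_, ?_,
      combo (a := ((Z - X / φ) / φ + Y) / 2) (b := ((Z - X / φ) / φ - Y) / 2) (c := X / φ)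
        (by linarith) (by linarith) (by positivity) ?_ ?_ ?_⟩
    · rw [inner_vec3]; linear_combination φ ^ 2 * q2 - q1 + hφ2
    · rw [inner_vec3]; linear_combination φ * q2
    · rw [inner_vec3]; linear_combination φ * q2
    all_goals field_simp; ring
  by_cases c2 : Y + φ ^ 2 * Z ≤ X * φ
  · have p : Y / φ + φ * Z ≤ X := by
      rw [div_add' _ _ _ hφ.ne', div_le_iff₀ hφ]; linarith
    have p2 : Z ≤ (X - Y / φ) / φ := by rw [le_div_iff₀ hφ]; linarith
    refine ⟨_, mQ he₂ he₀, _, mQ n2 he₀, _, mR he₀ he₁, ?_, ?_, ?_,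
      combo (a := ((X - Y / φ) / φ + Z) / 2) (b := ((X - Y / φ) / φ - Z) / 2) (c := Y / φ)
        (by linarith) (by linarith) (by positivity) ?_ ?_ ?_⟩
    · rw [inner_vec3]; linear_combination φ ^ 2 * q0 - q2 + hφ2
    · rw [inner_vec3]; linear_combination φ * q0
    · rw [inner_vec3]; linear_combination φ * q0
    all_goals field_simp; ring
  by_cases c3 : Z + φ ^ 2 * X ≤ Y * φ
  · have p : Z / φ + φ * X ≤ Y := by
      rw [div_add' _ _ _ hφ.ne', div_le_iff₀ hφ]; linarith
    have p2 : X ≤ (Y - Z / φ) / φ := by rw [le_div_iff₀ hφ]; linarith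
    refine ⟨_, mR he₀ he₁, _, mR n0 he₁, _, mP he₁ he₂, ?_, ?_, ?_,
      combo (a := ((Y - Z / φ) / φ + X) / 2) (b := ((Y - Z / φ) / φ - X) / 2) (c := Z / φ)
        (by linarith) (by linarith) (by positivity) ?_ ?_ ?_⟩
    · rw [inner_vec3]; linear_combination φ ^ 2 * q1 - q0 + hφ2
    · rw [inner_vec3]; linear_combination φ * q1
    · rw [inner_vec3]; linear_combination φ * q1
    all_goals field_simp; ring
  push Not at c1 c2 c3
  have hφ3 : φ ^ 3 = 2 * φ + 1 := by linear_combination φ * hφ2 + hφ2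
  refine ⟨_, mP he₁ he₂, _, mQ he₂ he₀, _, mR he₀ he₁, ?_, ?_, ?_,
    combo (a := (Y - φ * X + φ ^ 2 * Z) / (2 * φ ^ 2))
      (b := (Z - φ * Y + φ ^ 2 * X) / (2 * φ ^ 2))
      (c := (X - φ * Z + φ ^ 2 * Y) / (2 * φ ^ 2))
      (div_nonneg (by linarith) (by positivity)) (div_nonneg (by linarith) (by positivity))
      (div_nonneg (by linarith) (by positivity)) ?_ ?_ ?_⟩
  · rw [inner_vec3]; linear_combination φ * q2
  · rw [inner_vec3]; linear_combination φ * q1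
  · rw [inner_vec3]; linear_combination φ * q0
  · field_simp
    linear_combination (-e₀ * X) * (hφ3 - 2 * hφ2)
  · field_simp
    linear_combination (-e₁ * Y) * (hφ3 - 2 * hφ2)
  · field_simp
    linear_combination (-e₂ * Z) * (hφ3 - 2 * hφ2)

lemma goldenRatio_div_add_two : goldenRatio / (goldenRatio + 2) = 1 / √5 := by
  have h5 : √5 ^ 2 = 5 := Real.sq_sqrt (by norm_num)
  have : 0 < √5 := by positivity
  rw [goldenRatio]
  rw [div_eq_div_iff (by positivity) (by positivity)]
  linear_combination h5 / 2

lemma one_div_sqrt_five_bounds : 11 / 25 ≤ 1 / √5 ∧ 1 / √5 ≤ 9 / 20 := by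
  have h0 : 0 < √5 := by positivity
  constructor
  · rw [le_div_iff₀ h0]
    have : √5 ≤ 25 / 11 := Real.sqrt_le_iff.2 (by norm_num)
    linarith
  · rw [div_le_iff₀ h0]
    have : 20 / 9 ≤ √5 := Real.le_sqrt_of_sq_le (by norm_num)
    linarith

section icosahedron

variable {g : E3 ≃ₗᵢ[ℝ] E3}

lemma mem_icosahedron {p : E3} : p ∈ icosahedron g ↔
    ∃ w ∈ icosahedronRaw, p = g ((√(goldenRatio + 2))⁻¹ • w) := by
  constructor
  · rintro ⟨w, hw, rfl⟩
    exact ⟨w, hw, by simp only [norm_icosahedronRaw hw]⟩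
  · rintro ⟨w, hw, rfl⟩
    exact ⟨w, hw, by simp only [norm_icosahedronRaw hw]⟩

lemma inner_map_icosahedron (w w' : E3) :
    inner ℝ (g ((√(goldenRatio + 2))⁻¹ • w)) (g ((√(goldenRatio + 2))⁻¹ • w')) =
      inner ℝ w w' / (goldenRatio + 2) := by
  have h : 0 < goldenRatio + 2 := by linarith [goldenRatio_pos]
  rw [LinearIsometryEquiv.inner_map_map, real_inner_smul_left, real_inner_smul_right,
    ← mul_assoc, ← mul_inv, Real.mul_self_sqrt h.le]
  ring

lemma norm_icosahedron {p : E3} (hp : p ∈ icosahedron g) : ‖p‖ = 1 := by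
  obtain ⟨w, hw, rfl⟩ := mem_icosahedron.1 hp
  have h : 0 < goldenRatio + 2 := by linarith [goldenRatio_pos]
  rw [LinearIsometryEquiv.norm_map, norm_smul, norm_icosahedronRaw hw, norm_inv, Real.norm_eq_abs,
    abs_of_pos (Real.sqrt_pos.2 h), inv_mul_cancel₀ (Real.sqrt_pos.2 h).ne']

lemma inner_icosahedron {p q : E3} (hp : p ∈ icosahedron g) (hq : q ∈ icosahedron g) :
    p = q ∨ p = -q ∨ inner ℝ p q = 1 / √5 ∨ inner ℝ p q = -(1 / √5) := by
  obtain ⟨w, hw, rfl⟩ := mem_icosahedron.1 hp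
  obtain ⟨w', hw', rfl⟩ := mem_icosahedron.1 hq
  rw [inner_map_icosahedron, ← goldenRatio_div_add_two]
  rcases inner_icosahedronRaw hw hw' with h | h | h | h
  · left; rw [h]
  · right; left; rw [h, smul_neg, map_neg]
  · right; right; left; rw [h]
  · right; right; right; rw [h, neg_div]

lemma inner_icosahedron_le {p q : E3} (hp : p ∈ icosahedron g) (hq : q ∈ icosahedron g)
    (hpq : p ≠ q) : inner ℝ p q ≤ 1 / √5 := by
  have h0 : 0 < 1 / √5 := by positivity
  rcases inner_icosahedron hp hq with h | h | h | h
  · exact absurd h hpq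
  · rw [h, inner_neg_left, inner_self_of_unit (norm_icosahedron hq)]
    linarith
  · exact h.le
  · rw [h]; linarith

lemma neg_mem_icosahedron {p : E3} (hp : p ∈ icosahedron g) : -p ∈ icosahedron g := by
  obtain ⟨w, hw, rfl⟩ := mem_icosahedron.1 hp
  exact mem_icosahedron.2 ⟨-w, neg_mem_icosahedronRaw hw, by rw [smul_neg, map_neg]⟩

lemma ncard_icosahedron : (icosahedron g).ncard = 12 := by
  have h : 0 < √(goldenRatio + 2) := Real.sqrt_pos.2 (by linarith [goldenRatio_pos])
  have e : icosahedron g = (fun w => g ((√(goldenRatio + 2))⁻¹ • w)) '' icosahedronRaw := by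
    ext p
    rw [mem_icosahedron]
    simp only [Set.mem_image, eq_comm]
  rw [e, Set.ncard_image_of_injective, ncard_icosahedronRaw]
  intro w w' hw
  exact smul_right_injective E3 (inv_ne_zero h.ne') (g.injective hw)

lemma finite_icosahedron : (icosahedron g).Finite :=
  Set.finite_of_ncard_ne_zero (by rw [ncard_icosahedron]; norm_num)

lemma exists_icosahedron_cone (g : E3 ≃ₗᵢ[ℝ] E3) (x : E3) :
    ∃ u ∈ icosahedron g, ∃ v ∈ icosahedron g, ∃ w ∈ icosahedron g,
      inner ℝ u v = 1 / √5 ∧ inner ℝ u w = 1 / √5 ∧ inner ℝ v w = 1 / √5 ∧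
      x ∈ coneOver u v w := by
  obtain ⟨u, hu, v, hv, w, hw, h1, h2, h3, a, b, c, ha, hb, hc, e⟩ :=
    exists_icosahedronRaw_cone (g.symm x)
  have h : 0 < √(goldenRatio + 2) := Real.sqrt_pos.2 (by linarith [goldenRatio_pos])
  refine ⟨_, mem_icosahedron.2 ⟨u, hu, rfl⟩, _, mem_icosahedron.2 ⟨v, hv, rfl⟩, _,
    mem_icosahedron.2 ⟨w, hw, rfl⟩, ?_, ?_, ?_, a * √(goldenRatio + 2), b * √(goldenRatio + 2),
    c * √(goldenRatio + 2), by positivity, by positivity, by positivity, ?_⟩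
  · rw [inner_map_icosahedron, h1, goldenRatio_div_add_two]
  · rw [inner_map_icosahedron, h2, goldenRatio_div_add_two]
  · rw [inner_map_icosahedron, h3, goldenRatio_div_add_two]
  · rw [← g.apply_symm_apply x, e]
    simp only [map_add, map_smul, smul_smul, mul_assoc, mul_inv_cancel₀ h.ne', mul_one]

/-! ### Gaps, faces and hats of the spherical icosahedron -/

lemma sphDist_le_pi (p q : E3) : sphDist p q ≤ π := InnerProductGeometry.angle_le_pi p q

lemma sphDist_nonneg (p q : E3) : 0 ≤ sphDist p q := InnerProductGeometry.angle_nonneg p q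

lemma bddBelow_sphDist (S : Set E3) :
    BddBelow {d : ℝ | ∃ p ∈ S, ∃ q ∈ S, p ≠ q ∧ d = sphDist p q} :=
  ⟨0, by rintro d ⟨p, -, q, -, -, rfl⟩; exact sphDist_nonneg p q⟩

lemma minGap_le {S : Set E3} {p q : E3} (hp : p ∈ S) (hq : q ∈ S) (h : p ≠ q) :
    minGap S ≤ sphDist p q := csInf_le (bddBelow_sphDist S) ⟨p, hp, q, hq, h, rfl⟩

lemma le_minGap {S : Set E3} (hS : S.Nontrivial) (h1 : ∀ p ∈ S, ‖p‖ = 1) {d : ℝ} (hd0 : 0 ≤ d)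
    (hd1 : d ≤ π) (h : ∀ p ∈ S, ∀ q ∈ S, p ≠ q → inner ℝ p q ≤ cos d) : d ≤ minGap S := by
  obtain ⟨p, hp, q, hq, hpq⟩ := hS
  refine le_csInf ⟨_, p, hp, q, hq, hpq, rfl⟩ ?_
  rintro _ ⟨p, hp, q, hq, hpq, rfl⟩
  rw [sphDist_eq_arccos (h1 p hp) (h1 q hq), ← arccos_cos hd0 hd1]
  exact arccos_le_arccos (h p hp q hq hpq)

lemma cos_arccos_one_div_sqrt_five : cos (arccos (1 / √5)) = 1 / √5 :=
  cos_arccos (by linarith [one_div_sqrt_five_bounds.1]) (by linarith [one_div_sqrt_five_bounds.2])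

lemma one_div_sqrt_five_lt_one : 1 / √5 < 1 := by linarith [one_div_sqrt_five_bounds.2]

lemma arccos_one_div_sqrt_five_le_minGap {S : Set E3} (hS : S.Nontrivial)
    (h : S ⊆ icosahedron g) : arccos (1 / √5) ≤ minGap S := by
  refine le_minGap hS (fun p hp => norm_icosahedron (h hp)) (arccos_nonneg _) (arccos_le_pi _) ?_
  intro p hp q hq hpq
  rw [cos_arccos_one_div_sqrt_five]
  exact inner_icosahedron_le (h hp) (h hq) hpq

lemma minGap_le_arccos {S : Set E3} {p q : E3} (hp : p ∈ S) (hq : q ∈ S)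
    (hp1 : ‖p‖ = 1) (hq1 : ‖q‖ = 1) (h : inner ℝ p q = 1 / √5) :
    minGap S ≤ arccos (1 / √5) := by
  rw [← h, ← sphDist_eq_arccos hp1 hq1]
  refine minGap_le hp hq ?_
  rintro rfl
  rw [inner_self_of_unit hp1] at h
  linarith [one_div_sqrt_five_lt_one]

lemma minGap_icosahedron : minGap (icosahedron g) = arccos (1 / √5) := by
  obtain ⟨u, hu, v, hv, w, hw, h1, -⟩ := exists_icosahedron_cone g 0
  apply le_antisymm
  · exact minGap_le_arccos hu hv (norm_icosahedron hu) (norm_icosahedron hv) h1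
  · refine arccos_one_div_sqrt_five_le_minGap (g := g) ⟨u, hu, v, hv, ?_⟩ le_rfl
    rintro rfl
    rw [inner_self_of_unit (norm_icosahedron hu)] at h1
    linarith [one_div_sqrt_five_lt_one]

lemma sphDist_eq_minGap_iff {p q : E3} (hp : p ∈ icosahedron g) (hq : q ∈ icosahedron g) :
    sphDist p q = minGap (icosahedron g) ↔ inner ℝ p q = 1 / √5 := by
  rw [minGap_icosahedron, sphDist_eq_arccos (norm_icosahedron hp) (norm_icosahedron hq)]
  have hb := abs_le.1 (abs_real_inner_le_norm p q)
  rw [norm_icosahedron hp, norm_icosahedron hq] at hb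
  constructor
  · intro h
    refine arccos_injOn ⟨by linarith [hb.1], by linarith [hb.2]⟩ ?_ h
    exact ⟨by linarith [one_div_sqrt_five_bounds.1], one_div_sqrt_five_lt_one.le⟩
  · intro h; rw [h]

lemma mem_icosahedronFaces {T : SphTriangle} : T ∈ icosahedronFaces g ↔
    T.u₁ ∈ icosahedron g ∧ T.u₂ ∈ icosahedron g ∧ T.u₃ ∈ icosahedron g ∧
      inner ℝ T.u₁ T.u₂ = 1 / √5 ∧ inner ℝ T.u₁ T.u₃ = 1 / √5 ∧ inner ℝ T.u₂ T.u₃ = 1 / √5 := by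
  have ne : ∀ {p q : E3}, p ∈ icosahedron g → inner ℝ p q = 1 / √5 → p ≠ q := by
    rintro p _ hp h rfl
    rw [inner_self_of_unit (norm_icosahedron hp)] at h
    linarith [one_div_sqrt_five_lt_one]
  constructor
  · rintro ⟨h1, h2, h3, -, -, -, e1, e2, e3⟩
    exact ⟨h1, h2, h3, (sphDist_eq_minGap_iff h1 h2).1 e1, (sphDist_eq_minGap_iff h1 h3).1 e2,
      (sphDist_eq_minGap_iff h2 h3).1 e3⟩
  · rintro ⟨h1, h2, h3, e1, e2, e3⟩
    exact ⟨h1, h2, h3, ne h1 e1, ne h1 e2, ne h2 e3, (sphDist_eq_minGap_iff h1 h2).2 e1,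
      (sphDist_eq_minGap_iff h1 h3).2 e2, (sphDist_eq_minGap_iff h2 h3).2 e3⟩

lemma edgeBounds_icosahedronFaces : ∀ T ∈ icosahedronFaces g,
    EdgeBounds (1 / √5) (1 / √5) T.u₁ T.u₂ T.u₃ := by
  intro T hT
  obtain ⟨h1, h2, h3, e1, e2, e3⟩ := mem_icosahedronFaces.1 hT
  exact ⟨norm_icosahedron h1, norm_icosahedron h2, norm_icosahedron h3, e1.ge, e2.ge, e3.ge,
    e1.le, e2.le, e3.le⟩

lemma covers_icosahedronFaces : Covers (icosahedronFaces g) := by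
  intro x
  obtain ⟨u, hu, v, hv, w, hw, h1, h2, h3, hx⟩ := exists_icosahedron_cone g x
  exact ⟨⟨u, v, w⟩, mem_icosahedronFaces.2 ⟨hu, hv, hw, h1, h2, h3⟩, hx⟩

lemma finite_icosahedronFaces : (icosahedronFaces g).Finite := by
  have h := finite_icosahedron (g := g)
  refine ((h.prod (h.prod h)).image fun x => (⟨x.1, x.2.1, x.2.2⟩ : SphTriangle)).subset ?_
  rintro T hT
  obtain ⟨h1, h2, h3, -⟩ := mem_icosahedronFaces.1 hT
  exact ⟨(T.u₁, T.u₂, T.u₃), ⟨h1, h2, h3⟩, rfl⟩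

/-- The sum of the vertices is normal to the plane of the face: each face plane supports the
icosahedron. -/
lemma inner_sum_le {T : SphTriangle} (hT : T ∈ icosahedronFaces g) {p : E3}
    (hp : p ∈ icosahedron g) :
    inner ℝ p (T.u₁ + T.u₂ + T.u₃) ≤ 1 + 2 * (1 / √5) ∧
      (p ∉ T.vertices → inner ℝ p (T.u₁ + T.u₂ + T.u₃) ≤ 3 * (1 / √5)) := by
  obtain ⟨h1, h2, h3, e1, e2, e3⟩ := mem_icosahedronFaces.1 hT
  have e1' := (real_inner_comm T.u₁ T.u₂).trans e1
  have e2' := (real_inner_comm T.u₁ T.u₃).trans e2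
  have e3' := (real_inner_comm T.u₂ T.u₃).trans e3
  have l := one_div_sqrt_five_lt_one
  simp only [inner_add_right, SphTriangle.vertices, Set.mem_insert_iff, Set.mem_singleton_iff]
  have n : ¬ (p = T.u₁ ∨ p = T.u₂ ∨ p = T.u₃) →
      inner ℝ p T.u₁ + inner ℝ p T.u₂ + inner ℝ p T.u₃ ≤ 3 * (1 / √5) := by
    intro hn
    push Not at hn
    linarith [inner_icosahedron_le hp h1 hn.1, inner_icosahedron_le hp h2 hn.2.1,
      inner_icosahedron_le hp h3 hn.2.2]
  refine ⟨?_, n⟩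
  by_cases hm : p = T.u₁ ∨ p = T.u₂ ∨ p = T.u₃
  · rcases hm with rfl | rfl | rfl
    · rw [inner_self_of_unit (norm_icosahedron h1)]; linarith
    · rw [inner_self_of_unit (norm_icosahedron h2)]; linarith
    · rw [inner_self_of_unit (norm_icosahedron h3)]; linarith
  · linarith [n hm]

lemma inner_combination_sum {T : SphTriangle} (hT : T ∈ icosahedronFaces g) (a b c : ℝ) :
    inner ℝ (a • T.u₁ + b • T.u₂ + c • T.u₃) (T.u₁ + T.u₂ + T.u₃) =
      (1 + 2 * (1 / √5)) * (a + b + c) := by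
  obtain ⟨h1, h2, h3, e1, e2, e3⟩ := mem_icosahedronFaces.1 hT
  simp only [inner_add_left, inner_add_right, real_inner_smul_left,
    inner_self_of_unit (norm_icosahedron h1), inner_self_of_unit (norm_icosahedron h2),
    inner_self_of_unit (norm_icosahedron h3), real_inner_comm T.u₁ T.u₂,
    real_inner_comm T.u₁ T.u₃, real_inner_comm T.u₂ T.u₃, e1, e2, e3]
  ring

/-- Each vertex `p` lies in the cone of some face. Were it not a vertex of that face, then with `d =
1 / √5` the weights would satisfy `a + b + c ≤ 3 * d / (1 + 2 * d)` and `1 ≤ d * (a + b + c)`, which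
is impossible. -/
lemma vertexSet_icosahedronFaces : vertexSet (icosahedronFaces g) = icosahedron g := by
  ext p
  constructor
  · intro hp
    obtain ⟨T, hT, h⟩ := mem_vertexSet.1 hp
    obtain ⟨h1, h2, h3, -⟩ := mem_icosahedronFaces.1 hT
    rcases h with rfl | rfl | rfl <;> assumption
  · intro hp
    obtain ⟨T, hT, a, b, c, ha, hb, hc, e⟩ := covers_icosahedronFaces (g := g) p
    refine Set.mem_biUnion hT ?_
    by_contra hn
    have k := (inner_sum_le hT hp).2 hn
    have l := one_div_sqrt_five_bounds
    have s := inner_combination_sum hT a b c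
    rw [← e] at s
    obtain ⟨h1, h2, h3, -⟩ := mem_icosahedronFaces.1 hT
    simp only [SphTriangle.vertices, Set.mem_insert_iff, Set.mem_singleton_iff] at hn
    push Not at hn
    have k1 : (inner ℝ p p : ℝ) = a * inner ℝ p T.u₁ + b * inner ℝ p T.u₂ + c * inner ℝ p T.u₃ := by
      conv_lhs => rw [e, inner_add_left, inner_add_left, real_inner_smul_left,
        real_inner_smul_left, real_inner_smul_left, ← e]
      rw [real_inner_comm p T.u₁, real_inner_comm p T.u₂, real_inner_comm p T.u₃]
    rw [inner_self_of_unit (norm_icosahedron hp)] at k1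
    have m1 := mul_le_mul_of_nonneg_left (inner_icosahedron_le hp h1 hn.1) ha
    have m2 := mul_le_mul_of_nonneg_left (inner_icosahedron_le hp h2 hn.2.1) hb
    have m3 := mul_le_mul_of_nonneg_left (inner_icosahedron_le hp h3 hn.2.2) hc
    set d := 1 / √5
    nlinarith

/-- The gauge function of the icosahedron. -/
lemma exists_icosahedron_gauge (g : E3 ≃ₗᵢ[ℝ] E3) : ∃ N : E3 → ℝ, Continuous N ∧
    ∀ T ∈ icosahedronFaces g, ∀ a b c : ℝ, 0 ≤ a → 0 ≤ b → 0 ≤ c →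
      N (a • T.u₁ + b • T.u₂ + c • T.u₃) = a + b + c := by
  have hfin := finite_icosahedronFaces (g := g)
  have hne : hfin.toFinset.Nonempty := by
    obtain ⟨T, hT, -⟩ := covers_icosahedronFaces (g := g) 0
    exact ⟨T, hfin.mem_toFinset.2 hT⟩
  have hd : 0 < 1 + 2 * (1 / √5) := by positivity
  refine ⟨fun x => hfin.toFinset.sup' hne fun T =>
    inner ℝ x (T.u₁ + T.u₂ + T.u₃) / (1 + 2 * (1 / √5)), ?_, ?_⟩
  · refine Continuous.finset_sup'_apply hne fun T _ => ?_
    fun_prop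
  · intro T hT a b c ha hb hc
    apply le_antisymm
    · refine Finset.sup'_le _ _ fun S hS => ?_
      have hS := hfin.mem_toFinset.1 hS
      obtain ⟨h1, h2, h3, -⟩ := mem_icosahedronFaces.1 hT
      rw [div_le_iff₀ hd, inner_add_left, inner_add_left, real_inner_smul_left,
        real_inner_smul_left, real_inner_smul_left]
      have m1 := mul_le_mul_of_nonneg_left (inner_sum_le hS h1).1 ha
      have m2 := mul_le_mul_of_nonneg_left (inner_sum_le hS h2).1 hb
      have m3 := mul_le_mul_of_nonneg_left (inner_sum_le hS h3).1 hc
      linarith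
    · refine le_trans (le_of_eq ?_) (Finset.le_sup' _ (hfin.mem_toFinset.2 hT))
      rw [inner_combination_sum hT, mul_div_cancel_left₀ _ hd.ne']

/-- With the gauge `N`, the function `inner ℝ x p - 1 / √5 * N x` is linear on each face cone, zero
at the neighbours of `p` and negative at the remaining vertices other than `p`. Its positive part
therefore lives on the faces at `p`. -/
lemma hasHats_icosahedronFaces : HasHats (icosahedronFaces g) := by
  obtain ⟨N, hN, hN'⟩ := exists_icosahedron_gauge g
  intro p hp
  rw [vertexSet_icosahedronFaces] at hp
  have l := one_div_sqrt_five_lt_one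
  have l0 : 0 < 1 - 1 / √5 := by linarith
  have val : ∀ q ∈ icosahedron g,
      max 0 ((inner ℝ q p - 1 / √5) / (1 - 1 / √5)) = if q = p then 1 else 0 := by
    intro q hq
    split_ifs with e
    · rw [e, inner_self_of_unit (norm_icosahedron hp), div_self l0.ne']
      norm_num
    · refine max_eq_left (div_nonpos_of_nonpos_of_nonneg ?_ l0.le)
      linarith [inner_icosahedron_le hq hp e]
  have N1 : ∀ q ∈ icosahedron g, N q = 1 := by
    intro q hq
    rw [← vertexSet_icosahedronFaces] at hq
    obtain ⟨T, hT, rfl | rfl | rfl⟩ := mem_vertexSet.1 hq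
    · simpa using hN' T hT 1 0 0 zero_le_one le_rfl le_rfl
    · simpa using hN' T hT 0 1 0 le_rfl zero_le_one le_rfl
    · simpa using hN' T hT 0 0 1 le_rfl le_rfl zero_le_one
  refine ⟨fun x => max 0 ((inner ℝ x p - 1 / √5 * N x) / (1 - 1 / √5)), by fun_prop, ?_, ?_, ?_⟩
  · intro T hT a b c ha hb hc
    obtain ⟨h1, h2, h3, e1, e2, e3⟩ := mem_icosahedronFaces.1 hT
    have e1' := (real_inner_comm T.u₁ T.u₂).trans e1
    have e2' := (real_inner_comm T.u₁ T.u₃).trans e2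
    have e3' := (real_inner_comm T.u₂ T.u₃).trans e3
    simp only [hN' T hT a b c ha hb hc, N1 _ h1, N1 _ h2, N1 _ h3, mul_one, val _ h1, val _ h2,
      val _ h3, inner_add_left, real_inner_smul_left]
    by_cases hm : p ∈ T.vertices
    · have n12 : T.u₁ ≠ T.u₂ := (edgeBounds_icosahedronFaces T hT).ne₁₂ l
      have n13 : T.u₁ ≠ T.u₃ := (edgeBounds_icosahedronFaces T hT).swap'.ne₁₂ l
      have n23 : T.u₂ ≠ T.u₃ := (edgeBounds_icosahedronFaces T hT).swap.swap'.ne₁₂ l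
      simp only [SphTriangle.vertices, Set.mem_insert_iff, Set.mem_singleton_iff] at hm
      have fin : ∀ t y : ℝ, 0 ≤ t → y = t * (1 - 1 / √5) →
          max 0 (y / (1 - 1 / √5)) = t := by
        rintro t _ ht rfl
        rw [mul_div_cancel_right₀ _ l0.ne', max_eq_right ht]
      rcases hm with rfl | rfl | rfl
      · rw [if_pos rfl, if_neg n12.symm, if_neg n13.symm]
        rw [inner_self_of_unit (norm_icosahedron h1), e1', e2']
        rw [fin a _ ha (by ring)]; ring
      · rw [if_neg n12, if_pos rfl, if_neg n23.symm]
        rw [inner_self_of_unit (norm_icosahedron h2), e1, e3']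
        rw [fin b _ hb (by ring)]; ring
      · rw [if_neg n13, if_neg n23, if_pos rfl]
        rw [inner_self_of_unit (norm_icosahedron h3), e2, e3]
        rw [fin c _ hc (by ring)]; ring
    · simp only [SphTriangle.vertices, Set.mem_insert_iff, Set.mem_singleton_iff] at hm
      push Not at hm
      rw [if_neg hm.1.symm, if_neg hm.2.1.symm, if_neg hm.2.2.symm]
      have m1 := mul_le_mul_of_nonneg_left (inner_icosahedron_le h1 hp hm.1.symm) ha
      have m2 := mul_le_mul_of_nonneg_left (inner_icosahedron_le h2 hp hm.2.1.symm) hb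
      have m3 := mul_le_mul_of_nonneg_left (inner_icosahedron_le h3 hp hm.2.2.symm) hc
      rw [max_eq_left]
      · ring
      · refine div_nonpos_of_nonpos_of_nonneg ?_ l0.le
        linarith
  · have := val p hp
    simp only [N1 p hp, mul_one, this, if_true]
  · intro q hq hqp
    rw [vertexSet_icosahedronFaces] at hq
    have := val q hq
    simp only [N1 q hq, mul_one, this, if_neg hqp]

end icosahedron

/-! ### The tessellation of depth `k` -/

/-- The circumradius bound at depth `k`. -/
noncomputable def depthRadius (k : ℕ) : ℝ := (3 - √5) / 2 ^ k

/-- The cosine of the largest edge at depth `k`. -/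
noncomputable def depthCosMax (k : ℕ) : ℝ :=
  1 - 3 / 2 * (depthRadius k ^ 2 / (1 + depthRadius k ^ 2))

/-- The smallest edge at depth `k`. -/
noncomputable def depthGap (k : ℕ) : ℝ := arccos (1 / √5) / 2 ^ k

lemma sqrt_five_bounds : 2.236 ≤ √5 ∧ √5 ≤ 2.2361 :=
  ⟨Real.le_sqrt_of_sq_le (by norm_num), Real.sqrt_le_iff.2 (by norm_num)⟩

lemma depthRadius_succ (k : ℕ) : depthRadius (k + 1) = depthRadius k / 2 := by
  simp only [depthRadius, pow_succ]; ring

lemma depthGap_succ (k : ℕ) : depthGap (k + 1) = depthGap k / 2 := by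
  simp only [depthGap, pow_succ]; ring

lemma depthRadius_pos (k : ℕ) : 0 < depthRadius k :=
  div_pos (by linarith [sqrt_five_bounds.2]) (by positivity)

lemma depthCosMax_zero : depthCosMax 0 = 1 / √5 := by
  have h5 : √5 ^ 2 = 5 := Real.sq_sqrt (by norm_num)
  have h0 : 0 < √5 := by positivity
  simp only [depthCosMax, depthRadius, pow_zero, div_one]
  have : 0 < 1 + (3 - √5) ^ 2 := by positivity
  field_simp
  linear_combination (-√5 + 4) * h5

/-- An equilateral triangle of side cosine `C` and circumradius `R` has `cos R ^ 2 = (1 + 2 * C) /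
3`; here `tan R = depthRadius k`. Projected centrally to the plane of its vertices, the medial
triangle is the flat one of half the size, so `tan R` halves. -/
lemma depthCosMax_succ (k : ℕ) :
    depthCosMax (k + 1) * (2 * (1 + depthCosMax k)) = 1 + 3 * depthCosMax k := by
  simp only [depthCosMax, depthRadius_succ]
  have := depthRadius_pos k
  field_simp
  ring

lemma depthRadius_le (k : ℕ) : depthRadius k ≤ 4 / 5 := by
  rw [depthRadius, div_le_iff₀ (by positivity)]
  have : (1 : ℝ) ≤ 2 ^ k := one_le_pow₀ (by norm_num)
  nlinarith [sqrt_five_bounds.1]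

lemma depthCosMax_nonneg (k : ℕ) : 0 ≤ depthCosMax k := by
  have h1 := depthRadius_pos k
  have h2 := depthRadius_le k
  rw [depthCosMax, sub_nonneg, ← mul_div_assoc, div_le_one (by positivity)]
  nlinarith

lemma depthCosMax_le_one (k : ℕ) : depthCosMax k ≤ 1 := by
  rw [depthCosMax, sub_le_self_iff]; positivity

lemma arccos_one_div_sqrt_five_pos : 0 < arccos (1 / √5) :=
  arccos_pos.2 one_div_sqrt_five_lt_one

lemma depthGap_pos (k : ℕ) : 0 < depthGap k :=
  div_pos arccos_one_div_sqrt_five_pos (by positivity)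

lemma depthGap_le (k : ℕ) : depthGap k ≤ arccos (1 / √5) :=
  div_le_self arccos_one_div_sqrt_five_pos.le (one_le_pow₀ (by norm_num))

lemma depthGap_le_pi (k : ℕ) : depthGap k ≤ π := (depthGap_le k).trans (arccos_le_pi _)

lemma cos_depthGap_ge (k : ℕ) : 11 / 25 ≤ cos (depthGap k) := by
  refine one_div_sqrt_five_bounds.1.trans ?_
  rw [← cos_arccos_one_div_sqrt_five]
  exact cos_le_cos_of_nonneg_of_le_pi (depthGap_pos k).le (arccos_le_pi _) (depthGap_le k)

lemma cos_depthGap_lt_one (k : ℕ) : cos (depthGap k) < 1 := by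
  rw [← cos_zero]
  exact cos_lt_cos_of_nonneg_of_le_pi le_rfl (depthGap_le_pi k) (depthGap_pos k)

lemma cos_depthGap_succ (k : ℕ) : 2 * cos (depthGap (k + 1)) ^ 2 = 1 + cos (depthGap k) := by
  rw [depthGap_succ, cos_sq, mul_div_cancel₀ _ two_ne_zero]; ring

/-- Iterates `1 - cos (2 * θ) = 2 * (1 - cos θ) * (1 + cos θ) ≤ 4 * (1 - cos θ)`. -/
lemma one_sub_cos_depthGap_ge (k : ℕ) : 1 - 1 / √5 ≤ (1 - cos (depthGap k)) * 4 ^ k := by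
  induction k with
  | zero => simp [depthGap, cos_arccos_one_div_sqrt_five, -one_div]
  | succ k ih =>
    refine ih.trans ?_
    have h := cos_depthGap_succ k
    have h1 := cos_depthGap_lt_one (k + 1)
    have : 1 - cos (depthGap k) ≤ (1 - cos (depthGap (k + 1))) * 4 := by nlinarith
    rw [pow_succ', ← mul_assoc]
    gcongr

/-- Longest and shortest edges stay comparable at all depths. After scaling by `4 ^ k` what remains
is `15 / 2 * (14 - 6 * √5) ≤ 8 * (1 - 1 / √5)`, true with about one percent to spare. -/
lemma depthCosMax_compare (k : ℕ) : 5 * (1 - depthCosMax k) ≤ 8 * (1 - cos (depthGap k)) := by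
  have h5 : √5 ^ 2 = 5 := Real.sq_sqrt (by norm_num)
  have h1 : 1 - depthCosMax k ≤ 3 / 2 * depthRadius k ^ 2 := by
    rw [depthCosMax, sub_sub_cancel]
    gcongr
    exact div_le_self (sq_nonneg _) (by linarith [sq_nonneg (depthRadius k)])
  have h2 : depthRadius k ^ 2 * 4 ^ k = 14 - 6 * √5 := by
    rw [depthRadius, div_pow, ← pow_mul, mul_comm k 2, pow_mul]
    norm_num
    linear_combination h5
  have h3 := one_sub_cos_depthGap_ge k
  have h4 : (1 : ℝ) / √5 = √5 / 5 := by
    rw [div_eq_div_iff (by positivity) (by norm_num)]; linear_combination -h5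
  have hk : (0 : ℝ) < 4 ^ k := by positivity
  refine le_of_mul_le_mul_right ?_ hk
  have h6 := mul_le_mul_of_nonneg_right h1 hk.le
  rw [h4] at h3
  linarith [sqrt_five_bounds.1]

section tessellation

variable {g : E3 ≃ₗᵢ[ℝ] E3} {k : ℕ}

lemma tessellation_succ : tessellation g (k + 1) = dissectAll (tessellation g k) :=
  Function.iterate_succ_apply' _ _ _

lemma tessellationPoints_eq : tessellationPoints g k = vertexSet (tessellation g k) := rfl

lemma edgeBounds_tessellation : ∀ T ∈ tessellation g k,
    EdgeBounds (depthCosMax k) (cos (depthGap k)) T.u₁ T.u₂ T.u₃ := by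
  induction k with
  | zero =>
    have e : cos (depthGap 0) = 1 / √5 := by
      rw [depthGap, pow_zero, div_one, cos_arccos_one_div_sqrt_five]
    rw [e, depthCosMax_zero]
    exact edgeBounds_icosahedronFaces
  | succ k ih =>
    intro S hS
    rw [tessellation_succ] at hS
    have hC := depthCosMax_nonneg k
    have hA : 0 ≤ cos (depthGap (k + 1)) := by linarith [cos_depthGap_ge (k + 1)]
    exact exists_face_of_mem_dissectAll ih hS (fun _ _ _ h => h.swap)
      (fun _ _ _ f => f.bounds.corner hC hA (cos_depthGap_succ k) (depthCosMax_succ k))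
      (fun _ _ _ f => f.bounds.central hC hA (cos_depthGap_succ k) (depthCosMax_succ k))

lemma finite_vertexSet {F : Set SphTriangle} (hF : F.Finite) : (vertexSet F).Finite :=
  hF.biUnion fun T _ => by simp [SphTriangle.vertices]

lemma finite_tessellation : (tessellation g k).Finite := by
  induction k with
  | zero => exact finite_icosahedronFaces
  | succ k ih =>
    rw [tessellation_succ]
    exact ih.biUnion fun T _ => by simp [SphTriangle.dissect]

lemma Covers.dissectAll {F : Set SphTriangle} {C A : ℝ} (hC : 0 ≤ C) (h : Covers F)
    (hF : ∀ T ∈ F, EdgeBounds C A T.u₁ T.u₂ T.u₃) : Covers (dissectAll F) := by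
  intro x
  obtain ⟨T, hT, a, b, c, ha, hb, hc, rfl⟩ := h x
  have h12 := (hF T hT).norm_add_pos hC
  have h13 := (hF T hT).swap'.norm_add_pos hC
  have h23 := (hF T hT).swap.swap'.norm_add_pos hC
  by_cases c1 : b + c ≤ a
  · exact ⟨⟨T.u₁, _, _⟩, Set.mem_biUnion hT (.inl rfl), mem_coneOver_corner h12 h13 hb hc c1⟩
  by_cases c2 : a + c ≤ b
  · refine ⟨⟨_, T.u₂, _⟩, Set.mem_biUnion hT (.inr (.inl rfl)), ?_⟩
    have := mem_coneOver_corner (by rwa [add_comm] : 0 < ‖T.u₂ + T.u₁‖) h23 ha hc c2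
    rw [coneOver_swap, sphMidpoint_comm T.u₁]
    rwa [add_comm (a • T.u₁)]
  by_cases c3 : a + b ≤ c
  · refine ⟨⟨T.u₃, _, _⟩, Set.mem_biUnion hT (.inr (.inr (.inl rfl))), ?_⟩
    have := mem_coneOver_corner (by rwa [add_comm] : 0 < ‖T.u₃ + T.u₁‖)
      (by rwa [add_comm] : 0 < ‖T.u₃ + T.u₂‖) ha hb c3
    rw [sphMidpoint_comm T.u₁, sphMidpoint_comm T.u₂]
    rwa [add_comm (c • T.u₃ + a • T.u₁), ← add_assoc, add_right_comm, add_comm (b • T.u₂)] at this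
  · exact ⟨_, Set.mem_biUnion hT (.inr (.inr (.inr rfl))),
      mem_coneOver_central h12 h13 h23 (by linarith) (by linarith) (by linarith)⟩

lemma covers_tessellation : Covers (tessellation g k) := by
  induction k with
  | zero => exact covers_icosahedronFaces
  | succ k ih =>
    rw [tessellation_succ]
    exact ih.dissectAll (depthCosMax_nonneg k) edgeBounds_tessellation

lemma hasHats_tessellation : HasHats (tessellation g k) := by
  induction k with
  | zero => exact hasHats_icosahedronFaces
  | succ k ih =>
    rw [tessellation_succ]
    exact HasHats.dissectAll (depthCosMax_nonneg k) (cos_depthGap_lt_one k)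
      edgeBounds_tessellation ih (finite_vertexSet finite_tessellation)

lemma finite_tessellationPoints : (tessellationPoints g k).Finite :=
  finite_vertexSet finite_tessellation

lemma tessellationPoints_zero : tessellationPoints g 0 = icosahedron g :=
  vertexSet_icosahedronFaces

lemma tessellationPoints_ssubset_succ : tessellationPoints g k ⊂ tessellationPoints g (k + 1) := by
  rw [tessellationPoints_eq, tessellationPoints_eq, tessellation_succ]
  obtain ⟨T, hT, -⟩ := covers_tessellation (g := g) (k := k) 0
  exact vertexSet_ssubset_dissectAll (depthCosMax_nonneg k) (cos_depthGap_lt_one k)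
    edgeBounds_tessellation hasHats_tessellation ⟨T, hT⟩

lemma norm_tessellationPoints {p : E3} (hp : p ∈ tessellationPoints g k) : ‖p‖ = 1 := by
  obtain ⟨T, hT, rfl | rfl | rfl⟩ := mem_vertexSet.1 hp
  exacts [(edgeBounds_tessellation T hT).norm₁, (edgeBounds_tessellation T hT).norm₂,
    (edgeBounds_tessellation T hT).norm₃]

lemma depthGap_le_minGap {S : Set E3} (hS : S.Nontrivial) (h : S ⊆ tessellationPoints g k) :
    depthGap k ≤ minGap S :=
  le_minGap hS (fun _ hp => norm_tessellationPoints (h hp)) (depthGap_pos k).le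
    (depthGap_le_pi k) fun _ hp _ hq hpq =>
      inner_le_of_hasHats finite_tessellation hasHats_tessellation covers_tessellation
        edgeBounds_tessellation (cos_depthGap_lt_one k) (cos_depthGap_ge k)
        (depthCosMax_nonneg k) (depthCosMax_compare k) (h hp) (h hq) hpq

/-! ### Covering radius and gap ratio between consecutive depths -/

lemma iInf_sphDist_le {S : Set E3} {x q : E3} (hq : q ∈ S) :
    ⨅ q : S, 2 * sphDist x (q : E3) ≤ 2 * sphDist x q :=
  ciInf_le (f := fun q : S => 2 * sphDist x (q : E3))
    ⟨0, by rintro _ ⟨q, rfl⟩; exact mul_nonneg zero_le_two (sphDist_nonneg _ _)⟩ ⟨q, hq⟩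

lemma maxGap_le {S : Set E3} {M : ℝ}
    (h : ∀ x : E3, ‖x‖ = 1 → ∃ q ∈ S, 2 * sphDist x q ≤ M) : maxGap S ≤ M := by
  have : Nonempty (Metric.sphere (0 : E3) 1) :=
    (NormedSpace.sphere_nonempty.2 zero_le_one).to_subtype
  refine ciSup_le fun x => ?_
  obtain ⟨q, hq, hx⟩ := h x (by simp)
  exact (iInf_sphDist_le hq).trans hx

/-- The circumradius bound is `arctan (depthRadius k)`. Weakening it to `depthRadius k` makes it
scale exactly by `2 ^ k`, so that the final ratio does not depend on the depth. -/
lemma exists_vertex_near (g : E3 ≃ₗᵢ[ℝ] E3) (k : ℕ) {x : E3} (hx : ‖x‖ = 1) :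
    ∃ q ∈ tessellationPoints g k, sphDist x q ≤ depthRadius k := by
  obtain ⟨T, hT, hxT⟩ := covers_tessellation (g := g) (k := k) x
  have hr := depthRadius_pos k
  have hρ : cos (arctan (depthRadius k)) ^ 2 = (1 + 2 * depthCosMax k) / 3 := by
    rw [cos_sq_arctan, depthCosMax]
    field_simp
    ring
  have fin : ∀ q ∈ tessellationPoints g k, cos (arctan (depthRadius k)) ≤ inner ℝ x q →
      sphDist x q ≤ depthRadius k := by
    intro q hq h
    rw [sphDist_eq_arccos hx (norm_tessellationPoints hq)]
    refine (arccos_le_arccos h).trans ?_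
    have h0 : 0 ≤ arctan (depthRadius k) := arctan_nonneg.2 hr.le
    have h1 := arctan_lt_pi_div_two (depthRadius k)
    rw [arccos_cos h0 (by linarith [pi_pos])]
    calc arctan (depthRadius k) ≤ tan (arctan (depthRadius k)) := le_tan h0 h1
      _ = depthRadius k := tan_arctan _
  rcases (edgeBounds_tessellation T hT).exists_vertex_near (depthCosMax_le_one k) hρ hxT hx
    with h | h | h
  · exact ⟨_, mem_vertexSet.2 ⟨T, hT, .inl rfl⟩, fin _ (mem_vertexSet.2 ⟨T, hT, .inl rfl⟩) h⟩
  · exact ⟨_, mem_vertexSet.2 ⟨T, hT, .inr (.inl rfl)⟩,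
      fin _ (mem_vertexSet.2 ⟨T, hT, .inr (.inl rfl)⟩) h⟩
  · exact ⟨_, mem_vertexSet.2 ⟨T, hT, .inr (.inr rfl)⟩,
      fin _ (mem_vertexSet.2 ⟨T, hT, .inr (.inr rfl)⟩) h⟩

lemma gapRatio_le_of_subset {S : Set E3} {m M : ℝ} (hm : 0 < m) (hM : 0 ≤ M)
    (h1 : maxGap S ≤ M) (h2 : m ≤ minGap S) : gapRatio S ≤ M / m :=
  div_le_div₀ hM h1 hm h2

lemma gapRatio_between_depths {S : Set E3} (hS : S.Nontrivial)
    (h1 : tessellationPoints g k ⊆ S) (h2 : S ⊆ tessellationPoints g (k + 1)) :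
    gapRatio S ≤ (12 - 4 * √5) / arccos (1 / √5) := by
  have hα := arccos_one_div_sqrt_five_pos
  have hr := depthRadius_pos k
  refine (gapRatio_le_of_subset (M := 2 * depthRadius k) (depthGap_pos (k + 1)) (by positivity)
    (maxGap_le fun x hx => ?_) (depthGap_le_minGap hS h2)).trans (le_of_eq ?_)
  · obtain ⟨q, hq, h⟩ := exists_vertex_near g k hx
    exact ⟨q, h1 hq, by linarith⟩
  · rw [depthRadius, depthGap, pow_succ]
    field_simp
    ring

end tessellation

/-! ### Sequences -/

/-- A strictly increasing chain of finite sets can be enumerated by a sequence without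
repetitions. -/
lemma exists_enumeration {α : Type*} {A : ℕ → Set α} (hfin : ∀ k, (A k).Finite)
    (hA : ∀ k, A k ⊂ A (k + 1)) :
    ∃ p : ℕ → α, Function.Injective p ∧ ∀ k, p '' Set.Iio (A k).ncard = A k := by
  classical
  let l : ℕ → List α := fun k => k.rec (hfin 0).toFinset.toList
    fun k L => L ++ ((hfin (k + 1)).toFinset \ (hfin k).toFinset).toList
  have l_succ : ∀ k, l (k + 1) = l k ++ ((hfin (k + 1)).toFinset \ (hfin k).toFinset).toList :=
    fun k => rfl
  have hmem : ∀ k x, x ∈ l k ↔ x ∈ A k := by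
    intro k
    induction k with
    | zero => intro x; simp [l]
    | succ k ih =>
      intro x
      have := @(hA k).1 x
      simp only [l_succ, List.mem_append, ih, Finset.mem_toList, Finset.mem_sdiff,
        Set.Finite.mem_toFinset]
      tauto
  have hnodup : ∀ k, (l k).Nodup := by
    intro k
    induction k with
    | zero => exact Finset.nodup_toList _
    | succ k ih =>
      rw [l_succ]
      refine ih.append (Finset.nodup_toList _) fun x hx hx' => ?_
      rw [Finset.mem_toList, Finset.mem_sdiff, Set.Finite.mem_toFinset,
        Set.Finite.mem_toFinset] at hx'
      exact hx'.2 ((hmem k x).1 hx)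
  have hlen : ∀ k, (l k).length = (A k).ncard := by
    intro k
    rw [← List.toFinset_card_of_nodup (hnodup k), Set.ncard_eq_toFinset_card _ (hfin k)]
    congr 1
    ext x
    simp [hmem]
  have hpre : ∀ {j k}, j ≤ k → l j <+: l k := by
    intro j k h
    induction h with
    | refl => exact List.prefix_rfl
    | step _ ih => exact ih.trans (List.prefix_append _ _)
  have hstrict : StrictMono fun k => (l k).length := by
    refine strictMono_nat_of_lt_succ fun k => ?_
    simp only [hlen]
    exact Set.ncard_lt_ncard (hA k) (hfin _)
  -- Strictly increasing lengths give `l (i + 1)` more than `i` entries, so `p i` can be read off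
  -- there; the prefix property makes the choice of list irrelevant.
  have hi : ∀ i, i < (l (i + 1)).length := fun i => hstrict.le_apply (x := i + 1)
  let p : ℕ → α := fun i => (l (i + 1))[i]'(hi i)
  have hp : ∀ k i, i < (l k).length → (l k)[i]? = some (p i) := by
    intro k i hik
    have e : (l (i + 1))[i]? = some (p i) := List.getElem?_eq_getElem (hi i)
    rw [← e]
    rcases le_total k (i + 1) with h | h
    · rw [(List.prefix_iff_getElem?.1 (hpre h)) i hik, List.getElem?_eq_getElem hik]
    · rw [(List.prefix_iff_getElem?.1 (hpre h)) i (hi i), List.getElem?_eq_getElem (hi i)]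
  refine ⟨p, ?_, ?_⟩
  · intro i j hij
    have h1 : i < (l (max i j + 1)).length := lt_of_le_of_lt (le_max_left i j) (hi _)
    have h2 : j < (l (max i j + 1)).length := lt_of_le_of_lt (le_max_right i j) (hi _)
    refine (List.getElem?_inj h1 (hnodup (max i j + 1))).1 ?_
    exact (hp (max i j + 1) i h1).trans
      ((congrArg some hij).trans (hp (max i j + 1) j h2).symm)
  · intro k
    ext x
    rw [← hmem k x, ← hlen k, List.mem_iff_getElem?]
    constructor
    · rintro ⟨i, h, rfl⟩
      exact ⟨i, hp k i h⟩
    · rintro ⟨i, h⟩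
      have hik : i < (l k).length := by
        by_contra hn
        rw [List.getElem?_eq_none (not_lt.1 hn)] at h
        cases h
      refine ⟨i, hik, ?_⟩
      rw [hp k i hik] at h
      exact Option.some.inj h

lemma ne_neg_of_norm_eq_one {p : E3} (hp : ‖p‖ = 1) : p ≠ -p := by
  intro h
  have h1 := inner_self_of_unit hp
  nth_rewrite 1 [h] at h1
  rw [inner_neg_left, inner_self_of_unit hp] at h1
  norm_num at h1

lemma exists_isIcosahedralSequence (g : E3 ≃ₗᵢ[ℝ] E3) :
    ∃ p : ℕ → E3, IsIcosahedralSequence g p := by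
  obtain ⟨v, hv⟩ : (icosahedron g).Nonempty :=
    Set.nonempty_of_ncard_ne_zero (by rw [ncard_icosahedron]; norm_num)
  have hne : v ≠ -v := ne_neg_of_norm_eq_one (norm_icosahedron hv)
  have hpair : ({v, -v} : Set E3) ⊆ icosahedron g := by
    rintro _ (rfl | rfl)
    exacts [hv, neg_mem_icosahedron hv]
  -- Two small sets in front of the tessellations force the enumeration to start with `v`, `-v`.
  let A : ℕ → Set E3 := fun k =>
    match k with
    | 0 => {v}
    | 1 => {v, -v}
    | k + 2 => tessellationPoints g k
  have hfin : ∀ k, (A k).Finite := by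
    rintro (_ | _ | k)
    · exact Set.finite_singleton v
    · exact Set.toFinite {v, -v}
    · exact finite_tessellationPoints
  have hA : ∀ k, A k ⊂ A (k + 1) := by
    rintro (_ | _ | k)
    · refine (Set.ssubset_iff_of_subset (Set.singleton_subset_iff.2 (.inl rfl))).2
        ⟨-v, .inr rfl, fun h => hne h.symm⟩
    · change ({v, -v} : Set E3) ⊂ tessellationPoints g 0
      rw [tessellationPoints_zero]
      refine hpair.ssubset_of_ne fun h => ?_
      have := ncard_icosahedron (g := g)
      rw [← h, Set.ncard_pair hne] at this
      norm_num at this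
    · exact tessellationPoints_ssubset_succ
  obtain ⟨p, hp, h⟩ := exists_enumeration hfin hA
  have h0 := h 0
  have h1 := h 1
  have h2 := h 2
  change p '' Set.Iio ({v} : Set E3).ncard = {v} at h0
  change p '' Set.Iio ({v, -v} : Set E3).ncard = {v, -v} at h1
  change p '' Set.Iio (tessellationPoints g 0).ncard = tessellationPoints g 0 at h2
  rw [Set.ncard_singleton] at h0
  rw [Set.ncard_pair hne] at h1
  rw [tessellationPoints_zero, ncard_icosahedron] at h2
  have e0 : p 0 = v := by
    have : p 0 ∈ p '' Set.Iio 1 := ⟨0, by simp, rfl⟩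
    rwa [h0] at this
  have e1 : p 1 = -v := by
    have : p 1 ∈ p '' Set.Iio 2 := ⟨1, by simp, rfl⟩
    rw [h1] at this
    rcases this with h | h
    · exact absurd (hp (h.trans e0.symm)) one_ne_zero
    · exact h
  exact ⟨p, hp, by rw [e0, e1], h2, fun k => ⟨_, h (k + 2)⟩⟩

section sequence

variable {g : E3 ≃ₗᵢ[ℝ] E3} {p : ℕ → E3}

lemma prefixConfig_mono {i j : ℕ} (h : i ≤ j) : prefixConfig p i ⊆ prefixConfig p j :=
  Set.image_mono (Set.Iio_subset_Iio h)

lemma mem_prefixConfig {i j : ℕ} (h : j < i) : p j ∈ prefixConfig p i := ⟨j, h, rfl⟩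

namespace IsIcosahedralSequence

lemma nontrivial_prefixConfig (hp : IsIcosahedralSequence g p) {i : ℕ} (hi : 2 ≤ i) :
    (prefixConfig p i).Nontrivial :=
  ⟨p 0, mem_prefixConfig (by omega), p 1, mem_prefixConfig (by omega),
    fun h => zero_ne_one (hp.injective h)⟩

lemma exists_depth (hp : IsIcosahedralSequence g p) {i : ℕ} (hi : 12 ≤ i) :
    ∃ k, tessellationPoints g k ⊆ prefixConfig p i ∧
      prefixConfig p i ⊆ tessellationPoints g (k + 1) := by
  choose n hn using hp.stage_two
  have hmono : StrictMono n := by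
    refine strictMono_nat_of_lt_succ fun k => ?_
    by_contra! h
    have := prefixConfig_mono (p := p) h
    rw [hn, hn] at this
    exact tessellationPoints_ssubset_succ.2 this
  -- Otherwise `p 12`, the thirteenth point, would be an icosahedron vertex, but the first twelve
  -- points already exhaust these.
  have hn0 : n 0 ≤ i := by
    by_contra! h
    have h12 : p 12 ∈ prefixConfig p (n 0) := mem_prefixConfig (by omega)
    rw [hn, tessellationPoints_zero, ← hp.stage_one] at h12
    obtain ⟨j, hj, e⟩ := h12
    rw [hp.injective e] at hj
    exact lt_irrefl 12 (Set.mem_Iio.1 hj)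
  have hex : ∃ k, i < n (k + 1) := ⟨i, hmono.le_apply (x := i + 1)⟩
  classical
  refine ⟨Nat.find hex, ?_, ?_⟩
  · rw [← hn]
    refine prefixConfig_mono ?_
    rcases h : Nat.find hex with _ | k
    · exact hn0
    · exact not_lt.1 (Nat.find_min hex (m := k) (by omega))
  · rw [← hn]
    exact prefixConfig_mono (Nat.find_spec hex).le

lemma gapRatio_le_of_twelve_le (hp : IsIcosahedralSequence g p) {i : ℕ} (hi : 12 ≤ i) :
    gapRatio (prefixConfig p i) ≤ (12 - 4 * √5) / arccos (1 / √5) := by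
  obtain ⟨k, h1, h2⟩ := hp.exists_depth hi
  exact gapRatio_between_depths (hp.nontrivial_prefixConfig (by omega)) h1 h2

lemma maxGap_le_pi (hp : IsIcosahedralSequence g p) {i : ℕ} (hi : 2 ≤ i) :
    maxGap (prefixConfig p i) ≤ π := by
  refine maxGap_le fun x _ => ?_
  have h : sphDist x (p 1) = π - sphDist x (p 0) := by
    rw [hp.antipodal]; exact InnerProductGeometry.angle_neg_right x (p 0)
  rcases le_total (sphDist x (p 0)) (π / 2) with h' | h'
  · exact ⟨p 0, mem_prefixConfig (by omega), by linarith⟩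
  · exact ⟨p 1, mem_prefixConfig (by omega), by linarith⟩

lemma gapRatio_le (hp : IsIcosahedralSequence g p) {i : ℕ} (hi : 2 ≤ i) :
    gapRatio (prefixConfig p i) ≤ π / arccos (1 / √5) := by
  have hα := arccos_one_div_sqrt_five_pos
  rcases le_total 12 i with h | h
  -- Here `12 - 4 * √5 ≤ 3.056 < π`.
  · refine (hp.gapRatio_le_of_twelve_le h).trans ?_
    gcongr
    linarith [sqrt_five_bounds.1, pi_gt_d2]
  · refine gapRatio_le_of_subset hα pi_pos.le (hp.maxGap_le_pi hi) ?_
    refine arccos_one_div_sqrt_five_le_minGap (g := g) (hp.nontrivial_prefixConfig hi) ?_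
    rw [← hp.stage_one]
    exact prefixConfig_mono h

lemma gapRatio_three (hp : IsIcosahedralSequence g p) :
    gapRatio (prefixConfig p 3) = π / arccos (1 / √5) := by
  have hV : ∀ j < 12, p j ∈ icosahedron g := fun j hj => by
    rw [← hp.stage_one]; exact mem_prefixConfig hj
  have u0 := norm_icosahedron (hV 0 (by norm_num))
  have u1 := norm_icosahedron (hV 1 (by norm_num))
  have u2 := norm_icosahedron (hV 2 (by norm_num))
  have hin : inner ℝ (p 2) (p 0) = 1 / √5 ∨ inner ℝ (p 2) (p 0) = -(1 / √5) := by
    rcases inner_icosahedron (hV 2 (by norm_num)) (hV 0 (by norm_num)) with h | h | h | h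
    · exact absurd (hp.injective h) (by norm_num)
    · rw [← hp.antipodal] at h
      exact absurd (hp.injective h) (by norm_num)
    · exact .inl h
    · exact .inr h
  have hmin : minGap (prefixConfig p 3) = arccos (1 / √5) := by
    apply le_antisymm
    · rcases hin with h | h
      · exact minGap_le_arccos (mem_prefixConfig (by norm_num)) (mem_prefixConfig (by norm_num))
          u2 u0 h
      · refine minGap_le_arccos (mem_prefixConfig (by norm_num)) (mem_prefixConfig (by norm_num))
          u2 u1 ?_
        rw [hp.antipodal, inner_neg_right, h, neg_neg]
    · refine arccos_one_div_sqrt_five_le_minGap (g := g)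
        (hp.nontrivial_prefixConfig (by norm_num)) ?_
      rw [← hp.stage_one]
      exact prefixConfig_mono (by norm_num)
  have hmax : maxGap (prefixConfig p 3) = π := by
    refine le_antisymm (hp.maxGap_le_pi (by norm_num)) ?_
    set d : ℝ := inner ℝ (p 2) (p 0) with hd
    have hd2 : d ^ 2 < 1 := by
      have l := one_div_sqrt_five_bounds
      rcases hin with h | h <;> rw [h] <;> nlinarith
    -- `y` is minus the component of `p 2` orthogonal to `p 0`: on the great circle polar to the
    -- pair, and pointing away from `p 2`.
    set y := d • p 0 - p 2 with hy
    have y0 : inner ℝ y (p 0) = 0 := by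
      rw [hy, inner_sub_left, real_inner_smul_left, inner_self_of_unit u0]; linarith
    have y2 : inner ℝ y (p 2) = d ^ 2 - 1 := by
      rw [hy, inner_sub_left, real_inner_smul_left, inner_self_of_unit u2,
        real_inner_comm (p 2) (p 0), ← hd]
      ring
    have hyne : y ≠ 0 := by
      intro h
      rw [h, inner_zero_left] at y2
      linarith
    have hnn : 0 < ‖y‖⁻¹ := inv_pos.2 (norm_pos_iff.2 hyne)
    have hx1 : ‖‖y‖⁻¹ • y‖ = 1 := norm_smul_inv_norm (𝕜 := ℝ) hyne
    have far : ∀ q ∈ prefixConfig p 3, π ≤ 2 * sphDist (‖y‖⁻¹ • y) q := by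
      have key : ∀ q : E3, inner ℝ y q ≤ 0 → π ≤ 2 * sphDist (‖y‖⁻¹ • y) q := by
        intro q h
        have : π / 2 ≤ sphDist y q := by
          rw [sphDist, InnerProductGeometry.angle, ← arccos_zero]
          refine arccos_le_arccos ?_
          exact div_nonpos_of_nonpos_of_nonneg h (by positivity)
        rw [sphDist, InnerProductGeometry.angle_smul_left_of_pos _ _ hnn]
        rw [sphDist] at this
        linarith
      rintro _ ⟨j, hj, rfl⟩
      have hj : j < 3 := hj
      apply key
      interval_cases j
      · exact y0.le
      · rw [hp.antipodal, inner_neg_right, y0, neg_zero]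
      · rw [y2]; linarith
    have hne : Nonempty (prefixConfig p 3) := ⟨⟨p 0, mem_prefixConfig (by norm_num)⟩⟩
    refine (le_ciInf fun q : prefixConfig p 3 => far q q.2).trans ?_
    refine le_ciSup (f := fun x : Metric.sphere (0 : E3) 1 =>
      ⨅ q : prefixConfig p 3, 2 * sphDist (x : E3) (q : E3)) ?_
      ⟨‖y‖⁻¹ • y, by simpa using hx1⟩
    -- A real supremum dominates its terms only when the family is bounded above.
    refine ⟨2 * π, ?_⟩
    rintro _ ⟨x, rfl⟩
    refine (iInf_sphDist_le (mem_prefixConfig (by norm_num : 0 < 3))).trans ?_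
    linarith [sphDist_le_pi (x : E3) (p 0)]
  rw [gapRatio, hmax, hmin]

end IsIcosahedralSequence

end sequence

theorem mainTheorem1 (g : E3 ≃ₗᵢ[ℝ] E3) :
    (∃ p : ℕ → E3, IsIcosahedralSequence g p) ∧
    ∀ p : ℕ → E3, IsIcosahedralSequence g p →
      IsGreatest {r : ℝ | ∃ i : ℕ, 2 ≤ i ∧ r = gapRatio (prefixConfig p i)}
        (Real.pi / Real.arccos (1 / Real.sqrt 5)) ∧
      ∀ i : ℕ, 12 ≤ i →
        gapRatio (prefixConfig p i) ≤
          (12 - 4 * Real.sqrt 5) / Real.arccos (1 / Real.sqrt 5) := by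
  refine ⟨exists_isIcosahedralSequence g, fun p hp => ⟨⟨?_, ?_⟩, fun i hi => ?_⟩⟩
  · exact ⟨3, by norm_num, hp.gapRatio_three.symm⟩
  · rintro r ⟨i, hi, rfl⟩
    exact hp.gapRatio_le hi
  · exact hp.gapRatio_le_of_twelve_le hi
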